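/- Let $\mathrm H$ be a real Hilbert space with scalar product $\langle\cdot,\cdot\rangle$. All limits in $\tau$ are taken as $\tau\to 0$, $\tau>0$, and $(t_n)\to 0$ denotes a sequence of positive reals tending to $0$. Limits of sets. For a family $(S_\tau)_{\tau>0}$ of subsets of $\mathrm E=\mathrm H\times\mathrm H$ or $\mathrm E=\mathrm H\times\mathbb R$, let $\limsup S_\tau$ (resp. $\mathrm{w}\text{-}\limsup S_\tau$) be the set of all $p\in\mathrm E$ for which there exist $(t_n)\to0$ and $p_n\to p$ strongly (resp. $p_n\rightharpoonup p$ weakly) with $p_n\in S_{t_n}$ for all $n$, and let $\liminf S_\tau$ be the set of all $p\in\mathrm E$ such that for every $(t_n)\to 0$ there exist $p_n\to p$ strongly and $N\in\mathbb N$ with $p_n\in S_{t_n}$ for all $n\ge N$. The family is PK-convergent if $\limsup S_\tau\subset\liminf S_\tau$, and M-convergent if $\mathrm{w}\text{-}\limsup S_\tau\subset\liminf S_\tau$; in both cases its limit is $\liminf S_\tau$. A family of functions $f_\tau:\mathrm H\to[-\infty,+\infty]$ is M-convergent if the epigraphs $\mathrm{Epi}(f_\tau)=\{(w,\lambda)\in\mathrm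 H\times\mathbb R : f_\tau(w)\le\lambda\}$ are M-convergent; its limit is the function whose epigraph is the limit of the epigraphs. A family of set-valued maps $A_\tau:\mathrm H\rightrightarrows\mathrm H$ is G-convergent if the graphs $\{(w,u) : u\in A_\tau(w)\}$ are PK-convergent; its limit is the set-valued map whose graph is the limit of the graphs. Functions and operators. $\Gamma_0(\mathrm H)$ is the set of proper lower semicontinuous convex functions $\mathrm H\to\mathbb R\cup\{+\infty\}$. For $g\in\Gamma_0(\mathrm H)$, $\partial g(x)=\{y\in\mathrm H : \langle y,z-x\rangle\le g(z)-g(x)\ \ \forall z\in\mathrm H\}$. A set-valued map $A$ is maximal monotone if it is monotone and every monotone set-valued map whose graph contains that of $A$ is equal to $A$. A supporting hyperplane of $g$ is a triple $(z,\xi,\beta)\in\mathrm H\times\mathrm H\times\mathbb R$ with $g(w)\ge\langle\xi,w\rangle+\beta$ for all $w\in\mathrm H$ and $g(z)=\langle\xi,z\rangle+\beta$. Difference quotients. Let $f:[0,\infty)\times\mathrm H\to\mathbb R\cup\{+\infty\}$ satisfy $f(t,\cdot)\in\Gamma_0(\mathrm H)$ for all $t\ge0$, write $\partial f(t,x)=\partial(f(t,\cdot))(x)$,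 let $x\in\mathrm H$ satisfy $f(t,x)\in\mathbb R$ for all $t\ge 0$, and let $v\in\partial f(0,x)$. For $\tau>0$ and $w\in\mathrm H$ put $$\Delta^2_\tau f(x|v)(w)=\frac{f(\tau,x+\tau w)-f(\tau,x)-\tau\langle v,w\rangle}{\tau^2},\qquad \Delta_\tau(\partial f)(x|v)(w)=\frac{\partial f(\tau,x+\tau w)-v}{\tau}.$$ The function $f$ is twice epi-differentiable at $x$ for $v$ if $(\Delta^2_\tau f(x|v))_{\tau>0}$ is M-convergent, and its limit is then denoted by $d^2_ef(x|v):\mathrm H\to[-\infty,+\infty]$. The map $\partial f$ is proto-differentiable at $x$ for $v$ if $(\Delta_\tau(\partial f)(x|v))_{\tau>0}$ is G-convergent, and its limit is then denoted by $D_p(\partial f)(x|v)$. Theorem. Suppose that there are supporting hyperplanes $(z_\tau,\xi_\tau,\beta_\tau)$ of $\Delta^2_\tau f(x|v)$, one for each $\tau>0$, that converge (strongly) in $\mathrm H\times\mathrm H\times\mathbb R$ to some $(z,\xi,\beta)$ as $\tau\to0$. Then the following assertions are equivalent: (i) $f$ is twice epi-differentiable at $x$ for $v$; (ii) $\partial f$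 is proto-differentiable at $x$ for $v$ and $D_p(\partial f)(x|v)$ is maximal monotone. In that case $d^2_ef(x|v)\in\Gamma_0(\mathrm H)$, $\beta\le d^2_ef(x|v)(0)\le0$, and $D_p(\partial f)(x|v)=\partial\big(d^2_ef(x|v)\big)$. -/

import Mathlib

open Filter Topology Set

noncomputable section

namespace EpiProto

/-! ### Limits of families of sets as the parameter tends to `0` from above

A family `S : ℝ → Set E` stands for `(S τ)` with `τ > 0`; its values at `τ ≤ 0` are never used. -/

section SetLimits

variable {E : Type*} [AddCommGroup E] [Module ℝ E] [TopologicalSpace E]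

/-- `t` is a sequence of positive parameters that tends to `0`. -/
def ParamSeq (t : ℕ → ℝ) : Prop :=
  (∀ n, 0 < t n) ∧ Tendsto t atTop (𝓝 0)

/-- Weak convergence of a sequence. -/
def WeakTendsto (x : ℕ → E) (x₀ : E) : Prop :=
  Tendsto (fun n => toWeakSpace ℝ E (x n)) atTop (𝓝 (toWeakSpace ℝ E x₀))

/-- The outer limit `limsup S_τ`. -/
def outerLim (S : ℝ → Set E) : Set E :=
  {x | ∃ t : ℕ → ℝ, ParamSeq t ∧ ∃ y : ℕ → E, Tendsto y atTop (𝓝 x) ∧ ∀ n, y n ∈ S (t n)}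

/-- The weak outer limit `w-limsup S_τ`. -/
def weakOuterLim (S : ℝ → Set E) : Set E :=
  {x | ∃ t : ℕ → ℝ, ParamSeq t ∧ ∃ y : ℕ → E, WeakTendsto y x ∧ ∀ n, y n ∈ S (t n)}

/-- The inner limit `liminf S_τ`. -/
def innerLim (S : ℝ → Set E) : Set E :=
  {x | ∀ t : ℕ → ℝ, ParamSeq t →
    ∃ y : ℕ → E, Tendsto y atTop (𝓝 x) ∧ ∃ N : ℕ, ∀ n, N ≤ n → y n ∈ S (t n)}

/-- Painlevé–Kuratowski convergence; the limit is then `innerLim S = outerLim S`. -/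
def PKConverges (S : ℝ → Set E) : Prop :=
  outerLim S ⊆ innerLim S

/-- Mosco convergence; the limit is then `innerLim S`, which equals all the other limits. -/
def MConverges (S : ℝ → Set E) : Prop :=
  weakOuterLim S ⊆ innerLim S

end SetLimits

section Hilbert

variable {H : Type*} [NormedAddCommGroup H] [InnerProductSpace ℝ H]

/-! ### Set-valued maps -/

/-- The graph of a set-valued map. -/
def graph (A : H → Set H) : Set (H × H) :=
  {p | p.2 ∈ A p.1}

/-- Graphical convergence of a family of set-valued maps. -/
def GConverges (A : ℝ → H → Set H) : Prop :=
  PKConverges (fun τ => graph (A τ))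

/-- The graphical limit of a (G-convergent) family: the set-valued map whose graph is the limit
of the graphs. -/
def gLim (A : ℝ → H → Set H) : H → Set H :=
  fun x => {y | (x, y) ∈ innerLim (fun τ => graph (A τ))}

/-- Monotone set-valued maps. -/
def IsMonotoneOp (A : H → Set H) : Prop :=
  ∀ p ∈ graph A, ∀ q ∈ graph A, 0 ≤ inner ℝ (q.2 - p.2) (q.1 - p.1)

/-- Maximal monotone set-valued maps. -/
def IsMaximalMonotoneOp (A : H → Set H) : Prop :=
  IsMonotoneOp A ∧ ∀ B : H → Set H, IsMonotoneOp B → graph A ⊆ graph B → A = B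

/-- The difference quotient `Δ_τ A(x|v)(w) = (A(τ, x + τ w) - v) / τ`. -/
def protoQuot (A : ℝ → H → Set H) (x v : H) (τ : ℝ) : H → Set H :=
  fun w => (fun u => τ⁻¹ • (u - v)) '' A τ (x + τ • w)

/-- Proto-differentiability of a parameterized set-valued map at `x` for `v`. -/
def ProtoDiffAt (A : ℝ → H → Set H) (x v : H) : Prop :=
  GConverges (protoQuot A x v)

/-- The proto-derivative `D_p A(x|v)`. -/
def protoDeriv (A : ℝ → H → Set H) (x v : H) : H → Set H :=
  gLim (protoQuot A x v)

/-! ### Extended-real-valued functions -/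

/-- The epigraph, as a subset of `H × ℝ`. -/
def epi (f : H → EReal) : Set (H × ℝ) :=
  {p | f p.1 ≤ (p.2 : EReal)}

/-- Mosco convergence of a family of extended-real-valued functions. -/
def MConvergesFun (F : ℝ → H → EReal) : Prop :=
  MConverges (fun τ => epi (F τ))

/-- The limit of an M-convergent family of functions, that is, the function whose epigraph is the
limit of the epigraphs (see `epi_eLim`). -/
def eLim (F : ℝ → H → EReal) : H → EReal :=
  fun z => sInf {a : EReal | ∃ l : ℝ, a = (l : EReal) ∧ (z, l) ∈ innerLim (fun τ => epi (F τ))}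

/-- The inner limit only depends on what happens in every neighbourhood, for small parameters. -/
theorem mem_innerLim_iff {X : Type*} [NormedAddCommGroup X] [NormedSpace ℝ X]
    (S : ℝ → Set X) (x : X) :
    x ∈ innerLim S ↔ ∀ ε > 0, ∀ᶠ τ in 𝓝[>] (0 : ℝ), ∃ y ∈ S τ, dist y x < ε := by
  constructor
  · intro hx ε hε
    rw [eventually_iff_seq_eventually]
    intro t ht
    rw [tendsto_nhdsWithin_iff] at ht
    obtain ⟨ht0, htpos⟩ := ht
    obtain ⟨N, hN⟩ := eventually_atTop.1 htpos
    have ht' : ParamSeq (fun n => t (n + N)) :=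
      ⟨fun n => hN _ (Nat.le_add_left _ _), (tendsto_add_atTop_iff_nat N).2 ht0⟩
    obtain ⟨y, hy, M, hM⟩ := hx _ ht'
    have h1 : ∀ᶠ n in atTop, dist (y n) x < ε := Metric.tendsto_nhds.1 hy ε hε
    have h2 : ∀ᶠ n in atTop, ∃ y ∈ S (t (n + N)), dist y x < ε := by
      filter_upwards [h1, eventually_ge_atTop M] with n hn hnM
      exact ⟨y n, hM n hnM, hn⟩
    obtain ⟨K, hK⟩ := eventually_atTop.1 h2
    refine eventually_atTop.2 ⟨K + N, fun n hn => ?_⟩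
    have := hK (n - N) (by omega)
    rwa [Nat.sub_add_cancel (by omega)] at this
  · intro h t ht
    have htt : Tendsto t atTop (𝓝[>] (0 : ℝ)) :=
      tendsto_nhdsWithin_iff.2 ⟨ht.2, Eventually.of_forall ht.1⟩
    have key : ∀ n, ∃ y : X, (S (t n)).Nonempty →
        y ∈ S (t n) ∧ dist y x < Metric.infDist x (S (t n)) + 1 / ((n : ℝ) + 1) := by
      intro n
      by_cases hne : (S (t n)).Nonempty
      · obtain ⟨y, hy, hd⟩ := (Metric.infDist_lt_iff hne
          (r := Metric.infDist x (S (t n)) + 1 / ((n : ℝ) + 1))).1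
            (lt_add_of_pos_right _ (by positivity))
        exact ⟨y, fun _ => ⟨hy, by rwa [dist_comm]⟩⟩
      · exact ⟨x, fun h => absurd h hne⟩
    choose y hy using key
    have hne : ∀ᶠ n in atTop, (S (t n)).Nonempty := by
      filter_upwards [htt.eventually (h 1 one_pos)] with n hn
      obtain ⟨z, hz, -⟩ := hn
      exact ⟨z, hz⟩
    refine ⟨y, ?_, ?_⟩
    · rw [Metric.tendsto_nhds]
      intro ε hε
      have hs : ∀ᶠ n : ℕ in atTop, 1 / ((n : ℝ) + 1) < ε / 2 :=
        (tendsto_one_div_add_atTop_nhds_zero_nat (𝕜 := ℝ)).eventually_lt_const (by positivity)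
      filter_upwards [hne, hs, htt.eventually (h (ε / 2) (by positivity))] with n h1 h2 h3
      obtain ⟨u, hu, hd⟩ := h3
      have h4 : Metric.infDist x (S (t n)) < ε / 2 :=
        (Metric.infDist_le_dist_of_mem hu).trans_lt (by rwa [dist_comm])
      linarith [(hy n h1).2]
    · obtain ⟨N, hN⟩ := eventually_atTop.1 hne
      exact ⟨N, fun n hn => (hy n (hN n hn)).1⟩

/-- The epigraph of `eLim F` is the inner limit of the epigraphs. -/
theorem epi_eLim (F : ℝ → H → EReal) :
    epi (eLim F) = innerLim (fun τ => epi (F τ)) := by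
  have up : ∀ (z : H) (l m : ℝ), l ≤ m → (z, l) ∈ innerLim (fun τ => epi (F τ)) →
      (z, m) ∈ innerLim (fun τ => epi (F τ)) := by
    intro z l m hlm h t ht
    obtain ⟨y, hy, N, hN⟩ := h t ht
    refine ⟨fun n => ((y n).1, (y n).2 + (m - l)), ?_, N, fun n hn => ?_⟩
    · have h1 : Tendsto (fun n => (y n).1) atTop (𝓝 z) := (continuous_fst.tendsto _).comp hy
      have h2 : Tendsto (fun n => (y n).2) atTop (𝓝 l) := (continuous_snd.tendsto _).comp hy
      have h3 := h1.prodMk_nhds (h2.add_const (m - l))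
      rwa [add_sub_cancel] at h3
    · have h4 : F (t n) (y n).1 ≤ ((y n).2 : EReal) := hN n hn
      exact h4.trans (EReal.coe_le_coe_iff.2 (by linarith))
  ext ⟨z, m⟩
  constructor
  · intro h
    rw [mem_innerLim_iff]
    intro ε hε
    have hlt : eLim F z < ((m + ε / 2 : ℝ) : EReal) :=
      lt_of_le_of_lt h (EReal.coe_lt_coe_iff.2 (by linarith))
    obtain ⟨a, ⟨l, rfl, hl⟩, hlm⟩ := sInf_lt_iff.1 hlt
    have h2 := up z l (m + ε / 2) (EReal.coe_lt_coe_iff.1 hlm).le hl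
    rw [mem_innerLim_iff] at h2
    filter_upwards [h2 (ε / 2) (by positivity)] with τ hτ
    obtain ⟨y, hy, hd⟩ := hτ
    refine ⟨y, hy, ?_⟩
    have h3 : dist ((z, m + ε / 2) : H × ℝ) (z, m) ≤ ε / 2 := by
      rw [Prod.dist_eq]
      simp only [dist_self, Real.dist_eq, add_sub_cancel_left]
      rw [abs_of_pos (by positivity)]
      exact (max_eq_right (by positivity)).le
    linarith [dist_triangle y ((z, m + ε / 2) : H × ℝ) (z, m)]
  · intro h
    exact sInf_le (a := (m : EReal)) ⟨m, rfl, h⟩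

/-- The set `Γ₀(H)` of proper lower semicontinuous convex functions `H → ℝ ∪ {+∞}`. -/
def Gamma0 (H : Type*) [NormedAddCommGroup H] [InnerProductSpace ℝ H] : Set (H → EReal) :=
  {f | (∀ x, f x ≠ ⊥) ∧ (∃ x, f x ≠ ⊤) ∧ IsClosed (epi f) ∧ Convex ℝ (epi f)}

/-- The set `Γ₀(·, H)` of parameterized functions `f : ℝ₊ × H → ℝ ∪ {+∞}` with
`f(t, ·) ∈ Γ₀(H)` for all `t ≥ 0`; values at `t < 0` are never used. -/
def Gamma0Param (H : Type*) [NormedAddCommGroup H] [InnerProductSpace ℝ H] :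
    Set (ℝ → H → EReal) :=
  {f | ∀ t, 0 ≤ t → f t ∈ Gamma0 H}

/-- The set `f⁻¹(·, ℝ)` of the points at which `f(t, ·)` is finite for all `t ≥ 0`. -/
def finitePoints (f : ℝ → H → EReal) : Set H :=
  {x | ∀ t, 0 ≤ t → f t x ≠ ⊥ ∧ f t x ≠ ⊤}

/-- The convex subdifferential. -/
def subdiff (f : H → EReal) : H → Set H :=
  fun x => {y | ∀ z, ((inner ℝ y (z - x) : ℝ) : EReal) ≤ f z - f x}

/-- The parameterized subdifferential `∂f(t, x) = ∂(f(t, ·))(x)`. -/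
def subdiffParam (f : ℝ → H → EReal) : ℝ → H → Set H :=
  fun t => subdiff (f t)

/-- The second-order difference quotient
`Δ²_τ f(x|v)(w) = (f(τ, x + τ w) - f(τ, x) - τ ⟨v, w⟩) / τ²`. -/
def secondQuot (f : ℝ → H → EReal) (x v : H) (τ : ℝ) : H → EReal :=
  fun w => (f τ (x + τ • w) - f τ x - ((τ * inner ℝ v w : ℝ) : EReal)) / ((τ ^ 2 : ℝ) : EReal)

/-- Twice epi-differentiability of `f` at `x` for `v`. -/
def TwiceEpiDiffAt (f : ℝ → H → EReal) (x v : H) : Prop :=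
  MConvergesFun (secondQuot f x v)

/-- The second epi-derivative `d²_e f(x|v)`. -/
def secondEpiDeriv (f : ℝ → H → EReal) (x v : H) : H → EReal :=
  eLim (secondQuot f x v)

/-- `(z, ξ, β)` is a supporting hyperplane of `f`. -/
def IsSupportingHyperplane (f : H → EReal) (z ξ : H) (β : ℝ) : Prop :=
  (∀ w, ((inner ℝ ξ w + β : ℝ) : EReal) ≤ f w) ∧ f z = ((inner ℝ ξ z + β : ℝ) : EReal)

/-- `(zf τ, ξf τ, βf τ)`, `τ > 0`, is a convergent supporting hyperplane of the family `F`, with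
limit `(z, ξ, β)` as `τ` tends to `0`. -/
def IsConvergentSupportingHyperplane (F : ℝ → H → EReal)
    (zf ξf : ℝ → H) (βf : ℝ → ℝ) (z ξ : H) (β : ℝ) : Prop :=
  (∀ τ, 0 < τ → IsSupportingHyperplane (F τ) (zf τ) (ξf τ) (βf τ)) ∧
    Tendsto (fun τ => (zf τ, ξf τ, βf τ)) (𝓝[>] (0 : ℝ)) (𝓝 (z, ξ, β))

end Hilbert

end EpiProto

end

noncomputable section

namespace EpiProto

variable {H : Type*} [NormedAddCommGroup H] [InnerProductSpace ℝ H]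

/-! ### Weak convergence -/

/-! The epigraph of a difference quotient is the preimage of the epigraph of `f τ` under an affine
bijection. Hence the quotients lie in `Gamma0 H` and their subdifferentials are the quotients of
`∂f` (`protoQuot_subdiffParam`). What remains is a form of Attouch's theorem, `mconvergesFun_iff`,
for functions `F τ` in `Gamma0 H` normalized by convergent supporting hyperplanes. These bound the
functions from below, bound the resolvents (`exists_norm_resolvent_le`), and fix the constants of
integration.

Under Mosco convergence, subgradient inequalities pass to strong limits. Conversely, if `y` is a
subgradient of the limit at `w`, the resolvents of `∂F τ` at `w + y` are bounded. Comparing values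
at a weak cluster point makes them converge strongly to `w`. Minty's criterion then gives maximality
of the limit.

If the graphical limit is maximal monotone, its resolvents are everywhere defined, being found as
weak cluster points (`exists_resolvent_gLim`). Summing subgradient inequalities along a fine chain
of resolvent points that starts at the hyperplane determines the values of `F τ` in the limit
(`exists_tendsto_value`). Given a weak limit `(w, l)` of epigraph points, the resolvent points of
`w` with parameter `α` then lie below height `l` in the inner limit. They tend to `w` as `α → 0`,
and the inner limit is closed. -/

theorem weakTendsto_iff {E : Type*} [AddCommGroup E] [Module ℝ E] [TopologicalSpace E]
    {x : ℕ → E} {x₀ : E} :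
    WeakTendsto x x₀ ↔ ∀ l : E →L[ℝ] ℝ, Tendsto (fun n => l (x n)) atTop (𝓝 (l x₀)) := by
  constructor
  · intro h l
    exact ((WeakBilin.eval_continuous (topDualPairing ℝ E).flip l).tendsto _).comp h
  · intro h
    have hind : IsInducing fun (x : WeakSpace ℝ E) (l : E →L[ℝ] ℝ) =>
        (topDualPairing ℝ E).flip x l := ⟨rfl⟩
    exact hind.tendsto_nhds_iff.2 (tendsto_pi_nhds.2 h)

/-- By the Riesz theorem, a functional on `H × ℝ` is an inner product in the first variable plus a
multiple of the second. -/
theorem weakTendsto_prod_iff [CompleteSpace H] {p : ℕ → H × ℝ} {p₀ : H × ℝ} :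
    WeakTendsto p p₀ ↔ (∀ a : H, Tendsto (fun n => inner ℝ a (p n).1) atTop (𝓝 (inner ℝ a p₀.1))) ∧
      Tendsto (fun n => (p n).2) atTop (𝓝 p₀.2) := by
  rw [weakTendsto_iff]
  constructor
  · intro h
    exact ⟨fun a => h ((innerSL ℝ a).comp (ContinuousLinearMap.fst ℝ H ℝ)),
      h (ContinuousLinearMap.snd ℝ H ℝ)⟩
  · rintro ⟨h1, h2⟩ l
    let l₁ : H →L[ℝ] ℝ := l.comp (ContinuousLinearMap.inl ℝ H ℝ)
    have key : ∀ q : H × ℝ,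
        l q = inner ℝ ((InnerProductSpace.toDual ℝ H).symm l₁) q.1 + q.2 * l (0, 1) := by
      intro q
      rw [InnerProductSpace.toDual_symm_apply]
      have : q = (q.1, (0 : ℝ)) + q.2 • ((0 : H), (1 : ℝ)) := by ext <;> simp
      conv_lhs => rw [this, map_add, map_smul]
      rfl
    rw [key p₀]
    refine Tendsto.congr (fun n => (key (p n)).symm) ?_
    exact (h1 _).add (h2.mul_const _)

theorem exists_norm_le_of_weak [CompleteSpace H] {w : ℕ → H} {w₀ : H}
    (hw : ∀ a : H, Tendsto (fun n => inner ℝ a (w n)) atTop (𝓝 (inner ℝ a w₀))) :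
    ∃ C, ∀ n, ‖w n‖ ≤ C := by
  obtain ⟨C, hC⟩ := banach_steinhaus (g := fun n => innerSL ℝ (w n)) (fun a => by
    obtain ⟨C, hC⟩ := (hw a).norm.bddAbove_range
    refine ⟨C, fun n => ?_⟩
    rw [innerSL_apply_apply, real_inner_comm]
    exact hC ⟨n, rfl⟩)
  exact ⟨C, fun n => by simpa using hC n⟩

/-- The error `⟨y n - y₀, w n⟩` vanishes because `w` is bounded. This is the only way products of
weakly convergent sequences are handled. -/
theorem tendsto_inner_of_strong_weak {w y : ℕ → H} {w₀ y₀ : H} {C : ℝ}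
    (hC : ∀ n, ‖w n‖ ≤ C) (hy : Tendsto y atTop (𝓝 y₀))
    (hw : ∀ a : H, Tendsto (fun n => inner ℝ a (w n)) atTop (𝓝 (inner ℝ a w₀))) :
    Tendsto (fun n => inner ℝ (y n) (w n)) atTop (𝓝 (inner ℝ y₀ w₀)) := by
  have h1 : Tendsto (fun n => inner ℝ (y n - y₀) (w n)) atTop (𝓝 0) := by
    refine squeeze_zero_norm (a := fun n => ‖y n - y₀‖ * C) (fun n => ?_) ?_
    · exact (norm_inner_le_norm _ _).trans (mul_le_mul_of_nonneg_left (hC n) (norm_nonneg _))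
    · simpa using (tendsto_iff_norm_sub_tendsto_zero.1 hy).mul_const C
  have h2 := h1.add (hw y₀)
  simpa [inner_sub_left] using h2

theorem exists_weak_subseq_of_separable [CompleteSpace H] [TopologicalSpace.SeparableSpace H]
    {w : ℕ → H} {C : ℝ} (hC : ∀ n, ‖w n‖ ≤ C) :
    ∃ (w₀ : H) (φ : ℕ → ℕ), StrictMono φ ∧
      ∀ a : H, Tendsto (fun n => inner ℝ a (w (φ n))) atTop (𝓝 (inner ℝ a w₀)) := by
  have hmem : ∀ n, StrongDual.toWeakDual (innerSL ℝ (w n)) ∈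
      WeakDual.toStrongDual ⁻¹' Metric.closedBall (0 : StrongDual ℝ H) C := by
    intro n
    rw [mem_preimage, StrongDual.toStrongDual_toWeakDual, mem_closedBall_zero_iff,
      innerSL_apply_norm]
    exact hC n
  obtain ⟨l, -, φ, hφ, hl⟩ := WeakDual.isSeqCompact_closedBall ℝ H 0 C hmem
  refine ⟨(InnerProductSpace.toDual ℝ H).symm (WeakDual.toStrongDual l), φ, hφ, fun a => ?_⟩
  have h1 := ((WeakDual.eval_continuous (𝕜 := ℝ) a).tendsto _).comp hl
  rw [real_inner_comm, InnerProductSpace.toDual_symm_apply]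
  exact h1.congr fun n => real_inner_comm _ _

/-- Bounded sequences of a Hilbert space have weakly convergent subsequences. -/
theorem exists_weak_subseq [CompleteSpace H] {w : ℕ → H} {C : ℝ} (hC : ∀ n, ‖w n‖ ≤ C) :
    ∃ (w₀ : H) (φ : ℕ → ℕ), StrictMono φ ∧
      ∀ a : H, Tendsto (fun n => inner ℝ a (w (φ n))) atTop (𝓝 (inner ℝ a w₀)) := by
  -- The closed span of the sequence is separable, and testing against `a` amounts to testing
  -- against its projection onto the span.
  let K : Submodule ℝ H := (Submodule.span ℝ (range w)).topologicalClosure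
  have hK : IsClosed (K : Set H) := Submodule.isClosed_topologicalClosure _
  have : CompleteSpace K := hK.completeSpace_coe
  have : TopologicalSpace.SeparableSpace K := by
    have h : TopologicalSpace.IsSeparable (K : Set H) := by
      rw [Submodule.topologicalClosure_coe]
      exact (((countable_range w).isSeparable).span (R := ℝ)).closure
    exact h.separableSpace
  have hwK : ∀ n, w n ∈ K := fun n =>
    Submodule.le_topologicalClosure _ (Submodule.subset_span ⟨n, rfl⟩)
  obtain ⟨k, φ, hφ, hk⟩ := exists_weak_subseq_of_separable (w := fun n => (⟨w n, hwK n⟩ : K)) hC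
  refine ⟨k, φ, hφ, fun a => ?_⟩
  have h2 : ∀ k : K, inner ℝ a (k : H) = inner ℝ (K.orthogonalProjectionOnto a) k := fun k =>
    (Submodule.inner_orthogonalProjectionOnto_eq_of_mem_right k a).symm
  rw [h2]
  exact (hk _).congr fun n => (h2 _).symm

/-! ### Subdifferentials and resolvents -/

/-- Quantifying over the epigraph avoids extended subtraction. Finiteness at `w` comes from testing
`z = w`, since both `⊤ - ⊤` and `⊥ - ⊥` equal `⊥` in `EReal`. -/
theorem mem_subdiff_iff {g : H → EReal} {w y : H} :
    y ∈ subdiff g w ↔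
      ∃ r : ℝ, g w = r ∧ ∀ p ∈ epi g, r + inner ℝ y (p.1 - w) ≤ p.2 := by
  constructor
  · intro h
    have h0 := h w
    cases hw : g w with
    | bot => exact absurd h0 (by simp [hw])
    | top => exact absurd h0 (by simp [hw])
    | coe r =>
      refine ⟨r, rfl, fun p hp => ?_⟩
      have h1 := h p.1
      rw [hw] at h1
      have h2 : ((inner ℝ y (p.1 - w) : ℝ) : EReal) ≤ (p.2 : EReal) - (r : EReal) :=
        h1.trans (EReal.sub_le_sub hp le_rfl)
      have h3 : inner ℝ y (p.1 - w) ≤ p.2 - r := by exact_mod_cast h2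
      linarith
  · rintro ⟨r, hr, h⟩ z
    rw [hr]
    cases hz : g z with
    | bot =>
      have h1 := h (z, r + inner ℝ y (z - w) - 1) (by simp [epi, hz])
      simp only at h1
      linarith
    | top => simp
    | coe s =>
      have h1 := h (z, s) (by simp [epi, hz])
      have h2 : inner ℝ y (z - w) ≤ s - r := by
        simp only at h1
        linarith
      exact_mod_cast h2

theorem isMonotoneOp_subdiff (g : H → EReal) : IsMonotoneOp (subdiff g) := by
  rintro ⟨a, b⟩ hp ⟨c, d⟩ hq
  obtain ⟨r, hr, h1⟩ := mem_subdiff_iff.1 hp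
  obtain ⟨s, hs, h2⟩ := mem_subdiff_iff.1 hq
  have h3 := h1 (c, s) (by simp [epi, hs])
  have h4 := h2 (a, r) (by simp [epi, hr])
  simp only [inner_sub_left, inner_sub_right] at *
  linarith

theorem norm_sub_midpoint_sq (u a b : H) :
    ‖u - (2⁻¹ : ℝ) • (a + b)‖ ^ 2 =
      ‖u - a‖ ^ 2 / 2 + ‖u - b‖ ^ 2 / 2 - ‖a - b‖ ^ 2 / 4 := by
  have h1 : u - (2⁻¹ : ℝ) • (a + b) = (2⁻¹ : ℝ) • ((u - a) + (u - b)) := by module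
  have h2 : a - b = (u - b) - (u - a) := by abel
  rw [h1, h2, norm_smul, mul_pow, norm_add_sq_real (u - a),
    norm_sub_sq_real (u - b), real_inner_comm (u - b)]
  norm_num
  ring

theorem norm_sq_add_smul (d e : H) (s : ℝ) :
    ‖d - s • e‖ ^ 2 = ‖d‖ ^ 2 - 2 * s * inner ℝ d e + s ^ 2 * ‖e‖ ^ 2 := by
  rw [norm_sub_sq_real, inner_smul_right, norm_smul, mul_pow, Real.norm_eq_abs, sq_abs]
  ring

/-- A coercive quadratic perturbation of a closed convex epigraph attains its minimum. -/
theorem exists_isMinOn_epi [CompleteSpace H] {S : Set (H × ℝ)} (hne : S.Nonempty)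
    (hcl : IsClosed S) (hcv : Convex ℝ S) {ξ : H} {β : ℝ}
    (hmin : ∀ p ∈ S, inner ℝ ξ p.1 + β ≤ p.2) (u : H) {c : ℝ} (hc : 0 < c) :
    ∃ p ∈ S, ∀ q ∈ S, p.2 + c * ‖u - p.1‖ ^ 2 ≤ q.2 + c * ‖u - q.1‖ ^ 2 := by
  let V : H × ℝ → ℝ := fun p => p.2 + c * ‖u - p.1‖ ^ 2
  have hbdd : BddBelow (V '' S) := by
    -- Lower bound for the affine minorant plus the quadratic term, by completing the square.
    refine ⟨inner ℝ ξ u + β - ‖ξ‖ ^ 2 / (4 * c), ?_⟩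
    rintro _ ⟨p, hp, rfl⟩
    have h1 := hmin p hp
    have h2 : inner ℝ ξ p.1 = inner ℝ ξ u - inner ℝ ξ (u - p.1) := by
      rw [inner_sub_right]; ring
    have h3 := real_inner_le_norm ξ (u - p.1)
    have h4 : ‖ξ‖ * ‖u - p.1‖ ≤ c * ‖u - p.1‖ ^ 2 + ‖ξ‖ ^ 2 / (4 * c) := by
      have h5 : c * ‖u - p.1‖ ^ 2 + ‖ξ‖ ^ 2 / (4 * c) - ‖ξ‖ * ‖u - p.1‖ =
          (2 * c * ‖u - p.1‖ - ‖ξ‖) ^ 2 / (4 * c) := by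
        field_simp
        ring
      have h6 : 0 ≤ (2 * c * ‖u - p.1‖ - ‖ξ‖) ^ 2 / (4 * c) := by positivity
      linarith
    simp only [V]
    linarith
  set m := sInf (V '' S) with hm
  have hmle : ∀ p ∈ S, m ≤ V p := fun p hp => csInf_le hbdd ⟨p, hp, rfl⟩
  have hex : ∀ n : ℕ, ∃ p ∈ S, V p < m + 1 / ((n : ℝ) + 1) := by
    intro n
    obtain ⟨_, ⟨p, hp, rfl⟩, hlt⟩ := exists_lt_of_csInf_lt (hne.image V)
      (lt_add_of_pos_right m (by positivity : 0 < 1 / ((n : ℝ) + 1)))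
    exact ⟨p, hp, hlt⟩
  choose p hpS hpV using hex
  -- Midpoints stay in `S`, so the parallelogram law makes minimizing sequences Cauchy in `H`.
  have hmid : ∀ a ∈ S, ∀ b ∈ S, c * ‖a.1 - b.1‖ ^ 2 ≤ 2 * (V a - m) + 2 * (V b - m) := by
    intro a ha b hb
    have hab : (2⁻¹ : ℝ) • (a + b) ∈ S := by
      rw [smul_add]
      exact hcv ha hb (by norm_num) (by norm_num) (by norm_num)
    have h1 := hmle _ hab
    simp only [V, Prod.smul_fst, Prod.smul_snd, Prod.fst_add, Prod.snd_add,
      norm_sub_midpoint_sq, smul_eq_mul] at h1 ⊢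
    linarith
  have hinv : Tendsto (fun n : ℕ => 1 / ((n : ℝ) + 1)) atTop (𝓝 0) :=
    tendsto_one_div_add_atTop_nhds_zero_nat
  have hcau : CauchySeq fun n => (p n).1 := by
    refine Metric.cauchySeq_iff'.2 fun ε hε => ?_
    obtain ⟨N, hN⟩ := (hinv.eventually_lt_const (by positivity : 0 < c * ε ^ 2 / 4)).exists
    refine ⟨N, fun n hn => ?_⟩
    have h1 := hmid _ (hpS n) _ (hpS N)
    have h2 : 1 / ((n : ℝ) + 1) ≤ 1 / ((N : ℝ) + 1) :=
      one_div_le_one_div_of_le (by positivity) (by exact_mod_cast Nat.succ_le_succ hn)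
    have h3 : c * ‖(p n).1 - (p N).1‖ ^ 2 < c * ε ^ 2 := by linarith [hpV n, hpV N]
    rw [dist_eq_norm]
    exact lt_of_pow_lt_pow_left₀ 2 hε.le (lt_of_mul_lt_mul_left h3 hc.le)
  obtain ⟨w, hw⟩ := cauchySeq_tendsto_of_complete hcau
  have hV : Tendsto (fun n => V (p n)) atTop (𝓝 m) := by
    refine tendsto_of_tendsto_of_tendsto_of_le_of_le tendsto_const_nhds ?_
      (fun n => hmle _ (hpS n)) (fun n => (hpV n).le)
    simpa using hinv.const_add m
  have hl : Tendsto (fun n => (p n).2) atTop (𝓝 (m - c * ‖u - w‖ ^ 2)) := by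
    refine (hV.sub (((tendsto_const_nhds.sub hw).norm.pow 2).const_mul c)).congr fun n => ?_
    simp [V]
  have hmem := hcl.mem_of_tendsto (hw.prodMk_nhds hl) (Eventually.of_forall hpS)
  exact ⟨_, hmem, fun q hq => by simpa using hmle q hq⟩

/-- The resolvent of the subdifferential of a closed convex function is everywhere defined. -/
theorem exists_resolvent_subdiff [CompleteSpace H] {g : H → EReal} (hg : g ∈ Gamma0 H)
    {ξ : H} {β : ℝ} (hmin : ∀ w, ((inner ℝ ξ w + β : ℝ) : EReal) ≤ g w) (u : H)
    {α : ℝ} (hα : 0 < α) : ∃ w, α⁻¹ • (u - w) ∈ subdiff g w := by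
  obtain ⟨hbot, ⟨a, ha⟩, hcl, hcv⟩ := hg
  have hmin' : ∀ p ∈ epi g, inner ℝ ξ p.1 + β ≤ p.2 := fun p hp =>
    EReal.coe_le_coe_iff.1 ((hmin p.1).trans hp)
  -- The resolvent point minimizes `g + ‖u - ·‖² / (2α)`.
  obtain ⟨⟨w, l⟩, hp, hm⟩ := exists_isMinOn_epi
    ⟨(a, (g a).toReal), (EReal.coe_toReal ha (hbot a)).ge⟩ hcl hcv hmin' u
    (by positivity : 0 < (2 * α)⁻¹)
  have hgt : g w ≠ ⊤ := ne_top_of_le_ne_top (EReal.coe_ne_top l) hp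
  have hgw : g w = l := by
    refine le_antisymm hp ?_
    have h1 := hm (w, (g w).toReal) (EReal.coe_toReal hgt (hbot w)).ge
    simp only [add_le_add_iff_right] at h1
    rw [← EReal.coe_toReal hgt (hbot w)]
    exact_mod_cast h1
  refine ⟨w, mem_subdiff_iff.2 ⟨l, hgw, fun q hq => ?_⟩⟩
  -- First-order optimality: compare the minimizer with the point at fraction `s` of the segment to
  -- `q`, divide by `s`, then let `s → 0`.
  have hs : ∀ s ∈ Ioc (0 : ℝ) 1,
      l + inner ℝ (α⁻¹ • (u - w)) (q.1 - w) ≤ q.2 + s * ((2 * α)⁻¹ * ‖q.1 - w‖ ^ 2) := by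
    rintro s ⟨hs0, hs1⟩
    have h1 := hm _ (hcv hp hq (sub_nonneg.2 hs1) hs0.le (by ring))
    have h2 : u - ((1 - s) • w + s • q.1) = (u - w) - s • (q.1 - w) := by module
    simp only [Prod.fst_add, Prod.smul_fst, Prod.snd_add, Prod.smul_snd, smul_eq_mul, h2,
      norm_sq_add_smul] at h1
    have h3 : (2 * α)⁻¹ * 2 = α⁻¹ := by field_simp
    rw [inner_smul_left, ← h3]
    simp only [conj_trivial]
    have h4 : 0 ≤ s * (q.2 + s * ((2 * α)⁻¹ * ‖q.1 - w‖ ^ 2) -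
        (l + (2 * α)⁻¹ * 2 * inner ℝ (u - w) (q.1 - w))) := by linarith
    linarith [nonneg_of_mul_nonneg_right h4 hs0]
  have ht : Tendsto (fun s : ℝ => q.2 + s * ((2 * α)⁻¹ * ‖q.1 - w‖ ^ 2)) (𝓝[>] 0) (𝓝 q.2) := by
    have : Continuous fun s : ℝ => q.2 + s * ((2 * α)⁻¹ * ‖q.1 - w‖ ^ 2) := by fun_prop
    simpa using (this.tendsto 0).mono_left nhdsWithin_le_nhds
  exact ge_of_tendsto ht (eventually_of_mem (Ioc_mem_nhdsGT one_pos) hs)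

/-! ### Monotone and maximal monotone maps -/

/-- Adjoining `p` to the graph keeps it monotone, so maximality forces `p` to be there already. -/
theorem IsMaximalMonotoneOp.mem_graph {A : H → Set H} (hA : IsMaximalMonotoneOp A) {p : H × H}
    (h : ∀ q ∈ graph A, 0 ≤ inner ℝ (p.2 - q.2) (p.1 - q.1)) : p ∈ graph A := by
  let B : H → Set H := fun a => {b | (a, b) = p ∨ b ∈ A a}
  have hB : IsMonotoneOp B := by
    rintro a (ha | ha) b (hb | hb)
    · rw [show b = a from hb.trans ha.symm]
      simp
    · rw [show a = p from ha]
      have := h b hb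
      rwa [← inner_neg_neg, neg_sub, neg_sub]
    · rw [show b = p from hb]
      exact h a ha
    · exact hA.1 a ha b hb
  have hAB := hA.2 B hB fun a ha => Or.inr ha
  rw [hAB]
  exact Or.inl rfl

/-- Equal sums make the two increments opposite, and monotonicity then gives `-‖q.1 - p.1‖² ≥ 0`. So
`w + y` parametrizes a monotone graph injectively. -/
theorem IsMonotoneOp.eq_of_add_eq {A : H → Set H} (hA : IsMonotoneOp A) {p q : H × H}
    (hp : p ∈ graph A) (hq : q ∈ graph A) (h : p.1 + p.2 = q.1 + q.2) : p = q := by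
  have h1 := hA p hp q hq
  have h2 : q.2 - p.2 = -(q.1 - p.1) := by
    rw [neg_sub, sub_eq_sub_iff_add_eq_add, add_comm, ← h, add_comm]
  rw [h2, inner_neg_left, real_inner_self_eq_norm_sq] at h1
  have h3 : q.1 - p.1 = 0 := by
    rw [← norm_eq_zero]
    exact pow_eq_zero_iff two_ne_zero |>.1 (le_antisymm (by linarith) (sq_nonneg _))
  have h4 := h2
  rw [h3, neg_zero] at h4
  exact Prod.ext (sub_eq_zero.1 h3).symm (sub_eq_zero.1 h4).symm

/-- A monotone map whose resolvent is everywhere defined is maximal. -/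
theorem IsMonotoneOp.isMaximal {A : H → Set H} (hA : IsMonotoneOp A)
    (h : ∀ u, ∃ w, u - w ∈ A w) : IsMaximalMonotoneOp A := by
  refine ⟨hA, fun B hB hAB => ?_⟩
  ext w y
  refine ⟨fun hy => hAB (a := (w, y)) hy, fun hy => ?_⟩
  obtain ⟨a, ha⟩ := h (w + y)
  have := hB.eq_of_add_eq (p := (w, y)) (q := (a, w + y - a)) hy
    (hAB (a := (a, w + y - a)) ha) (by simp)
  have h1 : (w, y) ∈ graph A := this ▸ ha
  exact h1

/-! ### Limits of families of sets -/

section Sets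

variable {X : Type*} [NormedAddCommGroup X]

theorem ParamSeq.tendsto {t : ℕ → ℝ} (ht : ParamSeq t) : Tendsto t atTop (𝓝[>] 0) :=
  tendsto_nhdsWithin_iff.2 ⟨ht.2, Eventually.of_forall ht.1⟩

theorem ParamSeq.comp {t : ℕ → ℝ} (ht : ParamSeq t) {φ : ℕ → ℕ} (hφ : Tendsto φ atTop atTop) :
    ParamSeq (fun n => t (φ n)) :=
  ⟨fun _ => ht.1 _, ht.2.comp hφ⟩

theorem paramSeq_one_div : ParamSeq fun n : ℕ => 1 / ((n : ℝ) + 1) :=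
  ⟨fun n => by positivity, tendsto_one_div_add_atTop_nhds_zero_nat⟩

theorem mem_innerLim_of_tendsto {S : ℝ → Set X} {p : X} {σ : ℝ → X}
    (hσ : Tendsto σ (𝓝[>] 0) (𝓝 p)) (hS : ∀ᶠ τ in 𝓝[>] (0 : ℝ), σ τ ∈ S τ) : p ∈ innerLim S :=
  fun _ ht => ⟨_, hσ.comp ht.tendsto, eventually_atTop.1 (ht.tendsto.eventually hS)⟩

/-- Points of `S τ` within `τ` of the infimal distance give one selection serving all parameter
sequences at once. -/
theorem exists_selection_of_mem_innerLim [NormedSpace ℝ X] {S : ℝ → Set X} {p : X} (hp : p ∈ innerLim S) :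
    ∃ σ : ℝ → X, Tendsto σ (𝓝[>] 0) (𝓝 p) ∧ ∀ᶠ τ in 𝓝[>] (0 : ℝ), σ τ ∈ S τ := by
  rw [mem_innerLim_iff] at hp
  have key : ∀ τ, ∃ y : X, 0 < τ → (S τ).Nonempty →
      y ∈ S τ ∧ dist y p < Metric.infDist p (S τ) + τ := by
    intro τ
    by_cases h : 0 < τ ∧ (S τ).Nonempty
    · obtain ⟨y, hy, hd⟩ := (Metric.infDist_lt_iff h.2
        (r := Metric.infDist p (S τ) + τ)).1 (lt_add_of_pos_right _ h.1)
      exact ⟨y, fun _ _ => ⟨hy, by rwa [dist_comm]⟩⟩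
    · exact ⟨p, fun h1 h2 => absurd ⟨h1, h2⟩ h⟩
  choose σ hσ using key
  have hpos : ∀ᶠ τ in 𝓝[>] (0 : ℝ), 0 < τ := self_mem_nhdsWithin
  refine ⟨σ, Metric.tendsto_nhds.2 fun ε hε => ?_, ?_⟩
  · have hs : ∀ᶠ τ in 𝓝[>] (0 : ℝ), τ < ε / 2 :=
      eventually_nhdsWithin_of_eventually_nhds (eventually_lt_nhds (by positivity))
    filter_upwards [hpos, hs, hp (ε / 2) (by positivity)] with τ h1 h2 ⟨y, hy, hd⟩
    have h3 : Metric.infDist p (S τ) < ε / 2 :=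
      (Metric.infDist_le_dist_of_mem hy).trans_lt (by rwa [dist_comm])
    linarith [(hσ τ h1 ⟨y, hy⟩).2]
  · filter_upwards [hpos, hp 1 one_pos] with τ h1 ⟨y, hy, _⟩
    exact (hσ τ h1 ⟨y, hy⟩).1

theorem isClosed_innerLim [NormedSpace ℝ X] (S : ℝ → Set X) : IsClosed (innerLim S) := by
  refine isClosed_of_closure_subset fun p hp => ?_
  rw [mem_innerLim_iff]
  intro ε hε
  obtain ⟨q, hq, hd⟩ := Metric.mem_closure_iff.1 hp (ε / 2) (by positivity)
  filter_upwards [(mem_innerLim_iff S q).1 hq (ε / 2) (by positivity)] with τ ⟨y, hy, hyq⟩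
  refine ⟨y, hy, ?_⟩
  have := dist_triangle_right y p q
  linarith

theorem convex_innerLim [NormedSpace ℝ X] {S : ℝ → Set X} (hS : ∀ τ, 0 < τ → Convex ℝ (S τ)) :
    Convex ℝ (innerLim S) := by
  intro p hp q hq a b ha hb hab
  obtain ⟨σ, hσ, hσS⟩ := exists_selection_of_mem_innerLim hp
  obtain ⟨ρ, hρ, hρS⟩ := exists_selection_of_mem_innerLim hq
  refine mem_innerLim_of_tendsto ((hσ.const_smul a).add (hρ.const_smul b)) ?_
  filter_upwards [hσS, hρS, self_mem_nhdsWithin] with τ h1 h2 h3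
  exact hS τ h3 h1 h2 ha hb hab

theorem innerLim_subset_outerLim (S : ℝ → Set X) : innerLim S ⊆ outerLim S := by
  intro p hp
  obtain ⟨y, hy, N, hN⟩ := hp _ paramSeq_one_div
  exact ⟨_, paramSeq_one_div.comp (tendsto_add_atTop_nat N), _,
    hy.comp (tendsto_add_atTop_nat N), fun n => hN _ (Nat.le_add_left _ _)⟩

theorem innerLim_congr {S T : ℝ → Set X} (h : ∀ τ, 0 < τ → S τ = T τ) :
    innerLim S = innerLim T := by
  ext p
  refine forall₂_congr fun t ht => ?_
  simp only [h _ (ht.1 _)]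

theorem outerLim_congr {S T : ℝ → Set X} (h : ∀ τ, 0 < τ → S τ = T τ) :
    outerLim S = outerLim T := by
  ext p
  refine exists_congr fun t => and_congr_right fun ht => ?_
  simp only [h _ (ht.1 _)]

end Sets

theorem exists_tendsto_of_eventually_mem_Icc {ι : Type*} {l : Filter ι} [l.NeBot] {g : ι → ℝ}
    (h : ∀ ε > 0, ∃ a b, b - a < ε ∧ ∀ᶠ i in l, g i ∈ Icc a b) : ∃ φ, Tendsto g l (𝓝 φ) := by
  refine cauchy_map_iff_exists_tendsto.1 (Metric.cauchy_iff.2 ⟨inferInstance, fun ε hε => ?_⟩)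
  obtain ⟨a, b, hab, hg⟩ := h ε hε
  exact ⟨Icc a b, hg, fun x hx y hy => (Real.dist_le_of_mem_Icc hx hy).trans_lt hab⟩

theorem graph_gLim {X : Type*} [NormedAddCommGroup X] (A : ℝ → X → Set X) : graph (gLim A) = innerLim fun τ => graph (A τ) := rfl

theorem mem_weakOuterLim [CompleteSpace H] {S : ℝ → Set (H × ℝ)} {p : H × ℝ} {t : ℕ → ℝ}
    (ht : ParamSeq t) {y : ℕ → H × ℝ}
    (h1 : ∀ a : H, Tendsto (fun n => inner ℝ a (y n).1) atTop (𝓝 (inner ℝ a p.1)))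
    (h2 : Tendsto (fun n => (y n).2) atTop (𝓝 p.2)) (hS : ∀ n, y n ∈ S (t n)) :
    p ∈ weakOuterLim S :=
  ⟨t, ht, y, weakTendsto_prod_iff.2 ⟨h1, h2⟩, hS⟩

theorem outerLim_subset_weakOuterLim [CompleteSpace H] (S : ℝ → Set (H × ℝ)) :
    outerLim S ⊆ weakOuterLim S := by
  rintro p ⟨t, ht, y, hy, hS⟩
  exact mem_weakOuterLim ht
    (fun a => tendsto_const_nhds.inner ((continuous_fst.tendsto p).comp hy))
    ((continuous_snd.tendsto p).comp hy) hS

/-! ### Convergent supporting hyperplanes -/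

theorem IsSupportingHyperplane.mem_subdiff {g : H → EReal} {z ξ : H} {β : ℝ}
    (h : IsSupportingHyperplane g z ξ β) : ξ ∈ subdiff g z := by
  refine mem_subdiff_iff.2 ⟨_, h.2, fun p hp => ?_⟩
  have h1 : inner ℝ ξ p.1 + β ≤ p.2 := EReal.coe_le_coe_iff.1 ((h.1 p.1).trans hp)
  rw [inner_sub_right]
  linarith

namespace IsConvergentSupportingHyperplane

variable {F : ℝ → H → EReal} {zf ξf : ℝ → H} {βf : ℝ → ℝ} {z ξ : H} {β : ℝ}

theorem tendsto_point (h : IsConvergentSupportingHyperplane F zf ξf βf z ξ β) :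
    Tendsto zf (𝓝[>] 0) (𝓝 z) :=
  (continuous_fst.tendsto _).comp h.2

theorem tendsto_slope (h : IsConvergentSupportingHyperplane F zf ξf βf z ξ β) :
    Tendsto ξf (𝓝[>] 0) (𝓝 ξ) :=
  ((continuous_fst.comp continuous_snd).tendsto _).comp h.2

theorem tendsto_const (h : IsConvergentSupportingHyperplane F zf ξf βf z ξ β) :
    Tendsto βf (𝓝[>] 0) (𝓝 β) :=
  ((continuous_snd.comp continuous_snd).tendsto _).comp h.2

theorem le_of_mem_epi (h : IsConvergentSupportingHyperplane F zf ξf βf z ξ β) {τ : ℝ}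
    (hτ : 0 < τ) {p : H × ℝ} (hp : p ∈ epi (F τ)) : inner ℝ (ξf τ) p.1 + βf τ ≤ p.2 :=
  EReal.coe_le_coe_iff.1 (((h.1 τ hτ).1 p.1).trans hp)

theorem mem_innerLim_epi (h : IsConvergentSupportingHyperplane F zf ξf βf z ξ β) :
    (z, inner ℝ ξ z + β) ∈ innerLim fun τ => epi (F τ) := by
  refine mem_innerLim_of_tendsto (h.tendsto_point.prodMk_nhds
    ((h.tendsto_slope.inner h.tendsto_point).add h.tendsto_const)) ?_
  filter_upwards [self_mem_nhdsWithin] with τ hτ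
  exact (h.1 τ hτ).2.le

theorem mem_innerLim_graph (h : IsConvergentSupportingHyperplane F zf ξf βf z ξ β) :
    (z, ξ) ∈ innerLim fun τ => graph (subdiff (F τ)) := by
  refine mem_innerLim_of_tendsto (h.tendsto_point.prodMk_nhds h.tendsto_slope) ?_
  filter_upwards [self_mem_nhdsWithin] with τ hτ
  exact (h.1 τ hτ).mem_subdiff

theorem le_of_mem_innerLim_epi (h : IsConvergentSupportingHyperplane F zf ξf βf z ξ β)
    {p : H × ℝ} (hp : p ∈ innerLim fun τ => epi (F τ)) : inner ℝ ξ p.1 + β ≤ p.2 := by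
  obtain ⟨σ, hσ, hS⟩ := exists_selection_of_mem_innerLim hp
  have h1 : Tendsto (fun τ => (σ τ).1) (𝓝[>] 0) (𝓝 p.1) := (continuous_fst.tendsto _).comp hσ
  have h2 : Tendsto (fun τ => (σ τ).2) (𝓝[>] 0) (𝓝 p.2) := (continuous_snd.tendsto _).comp hσ
  refine le_of_tendsto_of_tendsto ((h.tendsto_slope.inner h1).add h.tendsto_const) h2 ?_
  filter_upwards [hS, self_mem_nhdsWithin] with τ h3 h4
  exact h.le_of_mem_epi h4 h3

theorem le_eLim (h : IsConvergentSupportingHyperplane F zf ξf βf z ξ β) (w : H) :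
    ((inner ℝ ξ w + β : ℝ) : EReal) ≤ eLim F w := by
  refine le_sInf ?_
  rintro _ ⟨l, rfl, hl⟩
  exact EReal.coe_le_coe_iff.2 (h.le_of_mem_innerLim_epi hl)

/-- The limiting hyperplane is an affine minorant and its contact point has a finite value.
Closedness and convexity hold for inner limits. -/
theorem eLim_mem_Gamma0 (h : IsConvergentSupportingHyperplane F zf ξf βf z ξ β)
    (hF : ∀ τ, 0 < τ → F τ ∈ Gamma0 H) : eLim F ∈ Gamma0 H := by
  refine ⟨fun w => ne_bot_of_le_ne_bot (EReal.coe_ne_bot _) (h.le_eLim w),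
    ⟨z, ne_top_of_le_ne_top (EReal.coe_ne_top (inner ℝ ξ z + β)) ?_⟩, ?_, ?_⟩
  · exact (epi_eLim F).ge h.mem_innerLim_epi
  · rw [epi_eLim]
    exact isClosed_innerLim _
  · rw [epi_eLim]
    exact convex_innerLim fun τ hτ => (hF τ hτ).2.2.2

/-- With `d = zf - J`, monotonicity against `(zf, ξf)` gives `‖d‖² ≤ ⟨α ξf - u + zf, d⟩`, and the
left factor converges. -/
theorem exists_norm_resolvent_le (h : IsConvergentSupportingHyperplane F zf ξf βf z ξ β)
    {t : ℕ → ℝ} (ht : ParamSeq t) {u : H} {α : ℝ} (hα : 0 < α) {J : ℕ → H}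
    (hJ : ∀ n, α⁻¹ • (u - J n) ∈ subdiff (F (t n)) (J n)) : ∃ C, ∀ n, ‖J n‖ ≤ C := by
  have hz := h.tendsto_point.comp ht.tendsto
  obtain ⟨C, hC⟩ := ((((h.tendsto_slope.comp ht.tendsto).const_smul α).sub_const u).add
    hz).norm.bddAbove_range
  obtain ⟨D, hD⟩ := hz.norm.bddAbove_range
  refine ⟨D + C, fun n => ?_⟩
  have h1 : ‖zf (t n)‖ ≤ D := hD ⟨n, rfl⟩
  have h2 : ‖α • ξf (t n) - u + zf (t n)‖ ≤ C := hC ⟨n, rfl⟩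
  have h3 := isMonotoneOp_subdiff (F (t n)) (J n, _) (hJ n) (zf (t n), ξf (t n))
    (h.1 _ (ht.1 n)).mem_subdiff
  simp only at h3
  set d := zf (t n) - J n with hd
  have h4 : ξf (t n) - α⁻¹ • (u - J n) = α⁻¹ • ((α • ξf (t n) - u + zf (t n)) - d) := by
    have h5 : α • ξf (t n) - u + zf (t n) - d = α • ξf (t n) - (u - J n) := by rw [hd]; abel
    rw [h5, smul_sub α⁻¹ (α • ξf (t n)), inv_smul_smul₀ hα.ne']
  rw [h4, inner_smul_left, conj_trivial] at h3
  have h5 := nonneg_of_mul_nonneg_right h3 (inv_pos.2 hα)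
  rw [inner_sub_left, real_inner_self_eq_norm_sq] at h5
  have h6 := real_inner_le_norm (α • ξf (t n) - u + zf (t n)) d
  have h7 : ‖d‖ ≤ C := by
    by_contra! h8
    have h9 : 0 ≤ ‖α • ξf (t n) - u + zf (t n)‖ := norm_nonneg _
    nlinarith
  have h8 : J n = zf (t n) - d := by rw [hd]; abel
  rw [h8]
  exact (norm_sub_le _ _).trans (add_le_add h1 h7)

end IsConvergentSupportingHyperplane

/-! ### Mosco convergence implies graphical convergence of the subdifferentials -/

/-- Strong limits of subgradients are subgradients of the epi-limit. -/
theorem outerLim_graph_subdiff_subset [CompleteSpace H] {F : ℝ → H → EReal}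
    {zf ξf : ℝ → H} {βf : ℝ → ℝ} {z ξ : H} {β : ℝ}
    (h : IsConvergentSupportingHyperplane F zf ξf βf z ξ β) (hM : MConvergesFun F) :
    outerLim (fun τ => graph (subdiff (F τ))) ⊆ graph (subdiff (eLim F)) := by
  rintro ⟨w, y⟩ ⟨t, ht, p, hp, hpS⟩
  have hp1 : Tendsto (fun n => (p n).1) atTop (𝓝 w) := (continuous_fst.tendsto _).comp hp
  have hp2 : Tendsto (fun n => (p n).2) atTop (𝓝 y) := (continuous_snd.tendsto _).comp hp
  -- The values of `F` at the base points are not known to converge. The subgradient inequality is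
  -- therefore read as membership of a strongly convergent sequence in the epigraphs.
  have key : ∀ q ∈ epi (eLim F), (w, q.2 - inner ℝ y (q.1 - w)) ∈ epi (eLim F) := by
    intro q hq
    rw [epi_eLim] at hq ⊢
    obtain ⟨σ, hσ, hσS⟩ := exists_selection_of_mem_innerLim hq
    have h1 := ((continuous_fst.tendsto _).comp hσ).comp ht.tendsto
    have h2 := ((continuous_snd.tendsto _).comp hσ).comp ht.tendsto
    obtain ⟨N, hN⟩ := eventually_atTop.1 (ht.tendsto.eventually hσS)
    have h3 := hp1.prodMk_nhds (h2.sub (hp2.inner (h1.sub hp1)))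
    refine hM (outerLim_subset_weakOuterLim _ ⟨_, ht.comp (tendsto_add_atTop_nat N), _,
      h3.comp (tendsto_add_atTop_nat N), fun n => ?_⟩)
    obtain ⟨r, hr, hrp⟩ := mem_subdiff_iff.1 (hpS (n + N))
    have h4 := hrp _ (hN (n + N) (Nat.le_add_left _ _))
    simp only [epi, mem_ofPred_eq, Function.comp_apply, hr]
    exact EReal.coe_le_coe_iff.2 (by linarith)
  have hle : ∀ q ∈ epi (eLim F), eLim F w ≤ ((q.2 - inner ℝ y (q.1 - w) : ℝ) : EReal) := key
  have hbot : eLim F w ≠ ⊥ := ne_bot_of_le_ne_bot (EReal.coe_ne_bot _) (h.le_eLim w)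
  have htop : eLim F w ≠ ⊤ := ne_top_of_le_ne_top (EReal.coe_ne_top _)
    (hle _ ((epi_eLim F).ge h.mem_innerLim_epi))
  refine mem_subdiff_iff.2 ⟨(eLim F w).toReal, (EReal.coe_toReal htop hbot).symm, fun q hq => ?_⟩
  have h1 := hle q hq
  rw [← EReal.coe_toReal htop hbot, EReal.coe_le_coe_iff] at h1
  linarith

/-- Testing the resolvent inequality on a recovery sequence for `w` bounds `‖J - w‖²` by an
expression linear in the weakly convergent `J`. Its limit is `r₀ + ⟨y, w' - w⟩ - μ`, which is
nonpositive because `y` is a subgradient at `w`. -/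
theorem exists_resolvent_subseq_tendsto [CompleteSpace H] {F : ℝ → H → EReal}
    {zf ξf : ℝ → H} {βf : ℝ → ℝ} {z ξ : H} {β : ℝ}
    (h : IsConvergentSupportingHyperplane F zf ξf βf z ξ β) (hM : MConvergesFun F)
    {w y : H} (hy : y ∈ subdiff (eLim F) w) {t : ℕ → ℝ} (ht : ParamSeq t) {J : ℕ → H}
    (hJ : ∀ n, (w + y) - J n ∈ subdiff (F (t n)) (J n)) :
    ∃ φ : ℕ → ℕ, Tendsto (fun n => J (φ n)) atTop (𝓝 w) := by
  obtain ⟨C, hC⟩ := h.exists_norm_resolvent_le ht one_pos (u := w + y) (J := J) (by simpa using hJ)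
  obtain ⟨r₀, hr₀, hsub⟩ := mem_subdiff_iff.1 hy
  have hmem : (w, r₀) ∈ innerLim fun τ => epi (F τ) := by
    rw [← epi_eLim]
    exact hr₀.le
  obtain ⟨σ, hσ, hσS⟩ := exists_selection_of_mem_innerLim hmem
  choose r hr hrJ using fun n => mem_subdiff_iff.1 (hJ n)
  obtain ⟨w', φ, hφ, hw'⟩ := exists_weak_subseq hC
  have hupper : ∀ᶠ n in atTop, r n + ‖J n‖ ^ 2 ≤ (σ (t n)).2 - inner ℝ (w + y) (σ (t n)).1
      + inner ℝ (w + y) (J n) + inner ℝ (σ (t n)).1 (J n) := by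
    filter_upwards [ht.tendsto.eventually hσS] with n hn
    have h1 := hrJ n _ hn
    rw [inner_sub_left, inner_sub_right, inner_sub_right, real_inner_self_eq_norm_sq,
      real_inner_comm (σ (t n)).1 (J n)] at h1
    linarith
  have hlower : ∀ n, inner ℝ (ξf (t n)) (J n) + βf (t n) ≤ r n := fun n =>
    h.le_of_mem_epi (ht.1 n) (p := (J n, r n)) (hr n).le
  have lim : ∀ θ : ℕ → ℕ, Tendsto θ atTop atTop →
      (∀ a : H, Tendsto (fun n => inner ℝ a (J (θ n))) atTop (𝓝 (inner ℝ a w'))) →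
      Tendsto (fun n => (σ (t (θ n))).2 - inner ℝ (w + y) (σ (t (θ n))).1
        + inner ℝ (w + y) (J (θ n)) + inner ℝ (σ (t (θ n))).1 (J (θ n))) atTop
        (𝓝 (r₀ - inner ℝ (w + y) w + inner ℝ (w + y) w' + inner ℝ w w')) := by
    intro θ hθ hJθ
    have h0 := hσ.comp (ht.comp hθ).tendsto
    have h1 : Tendsto (fun n => (σ (t (θ n))).1) atTop (𝓝 w) := (continuous_fst.tendsto _).comp h0
    have h2 : Tendsto (fun n => (σ (t (θ n))).2) atTop (𝓝 r₀) := (continuous_snd.tendsto _).comp h0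
    exact ((h2.sub (tendsto_const_nhds.inner h1)).add (hJθ _)).add
      (tendsto_inner_of_strong_weak (fun n => hC (θ n)) h1 hJθ)
  obtain ⟨a, ha⟩ : ∃ a, ∀ᶠ n in atTop, a ≤ r (φ n) := by
    have h1 := (tendsto_inner_of_strong_weak (fun n => hC (φ n))
      (h.tendsto_slope.comp (ht.comp hφ.tendsto_atTop).tendsto) hw').add
      (h.tendsto_const.comp (ht.comp hφ.tendsto_atTop).tendsto)
    obtain ⟨a, ha⟩ := h1.bddBelow_range
    exact ⟨a, Eventually.of_forall fun n => (ha ⟨n, rfl⟩).trans (hlower (φ n))⟩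
  obtain ⟨b, hb⟩ : ∃ b, ∀ᶠ n in atTop, r (φ n) ≤ b := by
    obtain ⟨b, hb⟩ := (lim φ hφ.tendsto_atTop hw').bddAbove_range
    refine ⟨b, ?_⟩
    filter_upwards [hφ.tendsto_atTop.eventually hupper] with n hn
    have h1 := hb ⟨n, rfl⟩
    linarith [sq_nonneg ‖J (φ n)‖]
  obtain ⟨μ, -, ψ, hψ, hμ⟩ := tendsto_subseq_of_frequently_bounded (Metric.isBounded_Icc a b)
    (ha.and hb).frequently
  set θ : ℕ → ℕ := fun n => φ (ψ n) with hθdef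
  have hθ : Tendsto θ atTop atTop := hφ.tendsto_atTop.comp hψ.tendsto_atTop
  have hJθ : ∀ a : H, Tendsto (fun n => inner ℝ a (J (θ n))) atTop (𝓝 (inner ℝ a w')) :=
    fun a => (hw' a).comp hψ.tendsto_atTop
  have hrθ : Tendsto (fun n => r (θ n)) atTop (𝓝 μ) := hμ
  have hw'μ : (w', μ) ∈ epi (eLim F) := by
    rw [epi_eLim]
    exact hM (mem_weakOuterLim (ht.comp hθ) (y := fun n => (J (θ n), r (θ n))) hJθ hrθ
      fun n => (hr _).le)
  have hfin := hsub _ hw'μ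
  simp only at hfin
  have hbound := ((lim θ hθ hJθ).sub hrθ).sub (((hJθ w).const_mul 2).sub_const (‖w‖ ^ 2))
  have hsq : ∀ᶠ n in atTop, ‖J (θ n) - w‖ ^ 2 ≤ (σ (t (θ n))).2
      - inner ℝ (w + y) (σ (t (θ n))).1 + inner ℝ (w + y) (J (θ n))
      + inner ℝ (σ (t (θ n))).1 (J (θ n)) - r (θ n) - (2 * inner ℝ w (J (θ n)) - ‖w‖ ^ 2) := by
    filter_upwards [hθ.eventually hupper] with n hn
    rw [norm_sub_sq_real, real_inner_comm w]
    linarith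
  have hlim0 : r₀ - inner ℝ (w + y) w + inner ℝ (w + y) w' + inner ℝ w w' - μ
      - (2 * inner ℝ w w' - ‖w‖ ^ 2) = 0 := by
    refine le_antisymm ?_ (ge_of_tendsto hbound (hsq.mono fun n hn => (sq_nonneg _).trans hn))
    simp only [inner_sub_right, inner_add_left, real_inner_self_eq_norm_sq] at hfin ⊢
    linarith
  rw [hlim0] at hbound
  have hsq0 := squeeze_zero' (Eventually.of_forall fun n => sq_nonneg ‖J (θ n) - w‖) hsq hbound
  refine ⟨θ, tendsto_iff_norm_sub_tendsto_zero.2 ?_⟩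
  simpa using hsq0.sqrt

/-- Subgradients of the Mosco limit are strong limits of subgradients. -/
theorem graph_subdiff_eLim_subset [CompleteSpace H] {F : ℝ → H → EReal}
    {zf ξf : ℝ → H} {βf : ℝ → ℝ} {z ξ : H} {β : ℝ}
    (h : IsConvergentSupportingHyperplane F zf ξf βf z ξ β) (hF : ∀ τ, 0 < τ → F τ ∈ Gamma0 H)
    (hM : MConvergesFun F) :
    graph (subdiff (eLim F)) ⊆ innerLim fun τ => graph (subdiff (F τ)) := by
  rintro ⟨w, y⟩ hy t ht
  choose J hJ using fun n => exists_resolvent_subdiff (hF (t n) (ht.1 n)) (h.1 (t n) (ht.1 n)).1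
    (w + y) one_pos
  simp only [inv_one, one_smul] at hJ
  have hJw : Tendsto J atTop (𝓝 w) := tendsto_of_subseq_tendsto fun ns hns =>
    exists_resolvent_subseq_tendsto h hM hy (ht.comp hns) fun n => hJ (ns n)
  refine ⟨fun n => (J n, w + y - J n), ?_, 0, fun n _ => hJ n⟩
  have h1 := hJw.prodMk_nhds (hJw.const_sub (w + y))
  rwa [add_sub_cancel_left] at h1

theorem gLim_subdiff_eq [CompleteSpace H] {F : ℝ → H → EReal}
    {zf ξf : ℝ → H} {βf : ℝ → ℝ} {z ξ : H} {β : ℝ}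
    (h : IsConvergentSupportingHyperplane F zf ξf βf z ξ β) (hF : ∀ τ, 0 < τ → F τ ∈ Gamma0 H)
    (hM : MConvergesFun F) :
    gLim (fun τ => subdiff (F τ)) = subdiff (eLim F) := by
  ext w y
  exact ⟨fun hy => outerLim_graph_subdiff_subset h hM (innerLim_subset_outerLim _ hy),
    fun hy => graph_subdiff_eLim_subset h hF hM hy⟩

/-! ### Graphical convergence of the subdifferentials implies Mosco convergence -/

/-- A maximal monotone limit of subdifferentials has everywhere defined resolvents. -/
theorem exists_resolvent_gLim [CompleteSpace H] {F : ℝ → H → EReal}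
    {zf ξf : ℝ → H} {βf : ℝ → ℝ} {z ξ : H} {β : ℝ}
    (h : IsConvergentSupportingHyperplane F zf ξf βf z ξ β) (hF : ∀ τ, 0 < τ → F τ ∈ Gamma0 H)
    (hA : IsMaximalMonotoneOp (gLim fun τ => subdiff (F τ))) (u : H) {α : ℝ} (hα : 0 < α) :
    ∃ w, (w, α⁻¹ • (u - w)) ∈ innerLim fun τ => graph (subdiff (F τ)) := by
  have ht := paramSeq_one_div
  set t : ℕ → ℝ := fun n => 1 / ((n : ℝ) + 1)
  choose J hJ using fun n => exists_resolvent_subdiff (hF (t n) (ht.1 n)) (h.1 (t n) (ht.1 n)).1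
    u hα
  obtain ⟨C, hC⟩ := h.exists_norm_resolvent_le ht hα hJ
  obtain ⟨w, φ, hφ, hw⟩ := exists_weak_subseq hC
  refine ⟨w, hA.mem_graph fun q hq => ?_⟩
  rw [graph_gLim] at hq
  obtain ⟨σ, hσ, hσS⟩ := exists_selection_of_mem_innerLim hq
  have htφ := (ht.comp hφ.tendsto_atTop).tendsto
  have h1 := ((continuous_fst.tendsto _).comp hσ).comp htφ
  have h2 := ((continuous_snd.tendsto _).comp hσ).comp htφ
  have hCφ := fun n => hC (φ n)
  -- The term `‖J‖²` has no weak limit. It is replaced by its minorant `2⟨w, J⟩ - ‖w‖²`, which is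
  -- linear in `J` and exact at `J = w`.
  have hlim := (((((hw u).sub (tendsto_const_nhds.inner h1 (x := u))).sub
    (((hw w).const_mul 2).sub_const (‖w‖ ^ 2))).add
    (tendsto_inner_of_strong_weak hCφ h1 hw)).const_mul α⁻¹).sub
    ((tendsto_inner_of_strong_weak hCφ h2 hw).sub (h2.inner h1))
  have hge : 0 ≤ α⁻¹ * (inner ℝ u w - inner ℝ u q.1 - (2 * inner ℝ w w - ‖w‖ ^ 2)
      + inner ℝ q.1 w) - (inner ℝ q.2 w - inner ℝ q.2 q.1) := by
    refine ge_of_tendsto hlim ?_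
    filter_upwards [htφ.eventually hσS] with n hn
    have h3 := isMonotoneOp_subdiff _ _ hn (J (φ n), _) (hJ (φ n))
    have h4 := sq_nonneg ‖J (φ n) - w‖
    rw [norm_sub_sq_real, real_inner_comm w] at h4
    have h5 : inner ℝ (α⁻¹ • (u - J (φ n)) - (σ (t (φ n))).2) (J (φ n) - (σ (t (φ n))).1) =
        α⁻¹ * (inner ℝ u (J (φ n)) - inner ℝ u (σ (t (φ n))).1 - ‖J (φ n)‖ ^ 2
          + inner ℝ (σ (t (φ n))).1 (J (φ n))) - (inner ℝ (σ (t (φ n))).2 (J (φ n))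
          - inner ℝ (σ (t (φ n))).2 (σ (t (φ n))).1) := by
      rw [inner_sub_left, inner_smul_left, inner_sub_left, inner_sub_right, inner_sub_right,
        inner_sub_right, real_inner_self_eq_norm_sq,
        real_inner_comm (σ (t (φ n))).1 (J (φ n)), conj_trivial]
      ring
    refine h3.trans (h5.le.trans (sub_le_sub_right (mul_le_mul_of_nonneg_left ?_
      (inv_pos.2 hα).le) _))
    simp only [Function.comp_apply]
    linarith
  refine hge.trans_eq ?_
  rw [inner_sub_left, inner_smul_left, inner_sub_left, inner_sub_right, inner_sub_right,
    inner_sub_right, real_inner_self_eq_norm_sq, real_inner_comm q.1 w, conj_trivial]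
  ring

/-! ### Integration of subgradients along chains -/

theorem inner_le_toReal_sub_of_mem_subdiff {g : H → EReal} {p q : H × H}
    (hp : p ∈ graph (subdiff g)) (hq : q ∈ graph (subdiff g)) :
    inner ℝ p.2 (q.1 - p.1) ≤ (g q.1).toReal - (g p.1).toReal := by
  obtain ⟨r, hr, h1⟩ := mem_subdiff_iff.1 hp
  obtain ⟨s, hs, -⟩ := mem_subdiff_iff.1 hq
  have h2 := h1 (q.1, s) hs.le
  simp only [hr, hs, EReal.toReal_coe] at h2 ⊢
  linarith

theorem toReal_sub_le_inner_of_mem_subdiff {g : H → EReal} {p q : H × H}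
    (hp : p ∈ graph (subdiff g)) (hq : q ∈ graph (subdiff g)) :
    (g q.1).toReal - (g p.1).toReal ≤ inner ℝ q.2 (q.1 - p.1) := by
  have h := inner_le_toReal_sub_of_mem_subdiff hq hp
  rw [← neg_sub q.1 p.1, inner_neg_right] at h
  linarith

/-- Differences of values along a chain of converging subgradients. -/
theorem eventually_value_sub_mem_Icc {F : ℝ → H → EReal} {P : ℕ → H × H} {σ : ℕ → ℝ → H × H}
    (hσ : ∀ i, Tendsto (σ i) (𝓝[>] 0) (𝓝 (P i)))
    (hσS : ∀ i, ∀ᶠ τ in 𝓝[>] (0 : ℝ), σ i τ ∈ graph (subdiff (F τ))) (N : ℕ)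
    {ε : ℝ} (hε : 0 < ε) :
    ∀ᶠ τ in 𝓝[>] (0 : ℝ), (F τ (σ N τ).1).toReal - (F τ (σ 0 τ).1).toReal ∈
      Icc (∑ i ∈ Finset.range N, inner ℝ (P i).2 ((P (i + 1)).1 - (P i).1) - ε)
        (∑ i ∈ Finset.range N, inner ℝ (P (i + 1)).2 ((P (i + 1)).1 - (P i).1) + ε) := by
  have h1 := fun i => (continuous_fst.tendsto _).comp (hσ i)
  have h2 := fun i => (continuous_snd.tendsto _).comp (hσ i)
  have hL := tendsto_finsetSum (Finset.range N) fun i _ =>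
    (h2 i).inner (𝕜 := ℝ) ((h1 (i + 1)).sub (h1 i))
  have hU := tendsto_finsetSum (Finset.range N) fun i _ =>
    (h2 (i + 1)).inner (𝕜 := ℝ) ((h1 (i + 1)).sub (h1 i))
  filter_upwards [hL.eventually_const_lt (sub_lt_self _ hε),
    hU.eventually_lt_const (lt_add_of_pos_right _ hε),
    (Finset.range (N + 1)).eventually_all.2 fun i _ => hσS i] with τ h3 h4 h5
  have h6 : ∀ i ∈ Finset.range N, σ i τ ∈ graph (subdiff (F τ)) ∧
      σ (i + 1) τ ∈ graph (subdiff (F τ)) := by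
    intro i hi
    rw [Finset.mem_range] at hi
    exact ⟨h5 i (Finset.mem_range.2 (by omega)), h5 (i + 1) (Finset.mem_range.2 (by omega))⟩
  -- Telescoping reduces the claim to the two-sided bound on each link.
  rw [← Finset.sum_range_sub (fun i => (F τ (σ i τ).1).toReal)]
  exact ⟨h3.le.trans (Finset.sum_le_sum fun i hi =>
      inner_le_toReal_sub_of_mem_subdiff (h6 i hi).1 (h6 i hi).2),
    (Finset.sum_le_sum fun i hi =>
      toReal_sub_le_inner_of_mem_subdiff (h6 i hi).1 (h6 i hi).2).trans h4.le⟩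

/-- Bounds the gap of one link of a chain by the squared increment of the sum of point and
subgradient. -/
theorem inner_le_norm_add_sq {a b : H} (h : 0 ≤ inner ℝ b a) : inner ℝ b a ≤ ‖a + b‖ ^ 2 := by
  rw [norm_add_sq_real, real_inner_comm b a]
  linarith [sq_nonneg ‖a‖, sq_nonneg ‖b‖]

/-- The values along a selection of subgradients converge. -/
theorem exists_tendsto_value [CompleteSpace H] {F : ℝ → H → EReal}
    {zf ξf : ℝ → H} {βf : ℝ → ℝ} {z ξ : H} {β : ℝ}
    (h : IsConvergentSupportingHyperplane F zf ξf βf z ξ β) (hF : ∀ τ, 0 < τ → F τ ∈ Gamma0 H)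
    (hA : IsMaximalMonotoneOp (gLim fun τ => subdiff (F τ))) {p : H × H} {σ : ℝ → H × H}
    (hσ : Tendsto σ (𝓝[>] 0) (𝓝 p))
    (hσS : ∀ᶠ τ in 𝓝[>] (0 : ℝ), σ τ ∈ graph (subdiff (F τ))) :
    ∃ φ, Tendsto (fun τ => (F τ (σ τ).1).toReal) (𝓝[>] 0) (𝓝 φ) := by
  have hp : p ∈ graph (gLim fun τ => subdiff (F τ)) := mem_innerLim_of_tendsto hσ hσS
  have hbase : Tendsto (fun τ => (F τ (zf τ)).toReal) (𝓝[>] 0) (𝓝 (inner ℝ ξ z + β)) := by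
    refine ((h.tendsto_slope.inner h.tendsto_point).add h.tendsto_const).congr' ?_
    filter_upwards [self_mem_nhdsWithin] with τ hτ
    rw [(h.1 τ hτ).2, EReal.toReal_coe]
  refine exists_tendsto_of_eventually_mem_Icc fun ε hε => ?_
  set D : H := (p.1 + p.2) - (z + ξ) with hD
  obtain ⟨N, hN⟩ := exists_nat_gt (4 * ‖D‖ ^ 2 / ε)
  have hN0 : 0 < (N : ℝ) := lt_of_le_of_lt (by positivity) hN
  -- The chain follows the segment from `z + ξ` to `p.1 + p.2`. Each of its `N` links has gap at
  -- most `‖D‖² / N²`, so the total is at most `‖D‖² / N ≤ ε / 4`.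
  let u : ℕ → H := fun i => (z + ξ) + ((i : ℝ) / N) • D
  choose J hJ using fun i => exists_resolvent_gLim h hF hA (u i) one_pos
  simp only [inv_one, one_smul] at hJ
  let P : ℕ → H × H := fun i => (J i, u i - J i)
  have hPA : ∀ i, P i ∈ graph (gLim fun τ => subdiff (F τ)) := hJ
  have hP0 : P 0 = (z, ξ) :=
    hA.1.eq_of_add_eq (hPA 0) h.mem_innerLim_graph (by simp [P, u])
  have hPN : P N = p :=
    hA.1.eq_of_add_eq (hPA N) hp (by simp [P, u, hN0.ne', hD])
  choose ρ hρ hρS using fun i => exists_selection_of_mem_innerLim (hJ i)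
  -- The ends must be the prescribed selections: the values are known along `zf` and wanted along
  -- `σ`.
  let s : ℕ → ℝ → H × H := fun i =>
    if i = 0 then fun τ => (zf τ, ξf τ) else if i = N then σ else ρ i
  have hN1 : N ≠ 0 := by exact_mod_cast hN0.ne'
  have hs0 : s 0 = fun τ => (zf τ, ξf τ) := by simp [s]
  have hsN : s N = σ := by simp [s, hN1]
  have hs : ∀ i, Tendsto (s i) (𝓝[>] 0) (𝓝 (P i)) := by
    intro i
    by_cases h0 : i = 0
    · rw [h0, hs0, hP0]
      exact h.tendsto_point.prodMk_nhds h.tendsto_slope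
    · by_cases h1 : i = N
      · rw [h1, hsN, hPN]
        exact hσ
      · simpa [s, h0, h1] using hρ i
  have hsS : ∀ i, ∀ᶠ τ in 𝓝[>] (0 : ℝ), s i τ ∈ graph (subdiff (F τ)) := by
    intro i
    by_cases h0 : i = 0
    · rw [h0, hs0]
      filter_upwards [self_mem_nhdsWithin] with τ hτ
      exact (h.1 τ hτ).mem_subdiff
    · by_cases h1 : i = N
      · rw [h1, hsN]
        exact hσS
      · simpa [s, h0, h1] using hρS i
  have hev := eventually_value_sub_mem_Icc hs hsS N (by positivity : 0 < ε / 8)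
  rw [hs0, hsN] at hev
  set SL := ∑ i ∈ Finset.range N, inner ℝ (P i).2 ((P (i + 1)).1 - (P i).1)
  set SU := ∑ i ∈ Finset.range N, inner ℝ (P (i + 1)).2 ((P (i + 1)).1 - (P i).1)
  have hgap : SU - SL ≤ ε / 4 := by
    have h1 : ∀ i ∈ Finset.range N, inner ℝ (P (i + 1)).2 ((P (i + 1)).1 - (P i).1) -
        inner ℝ (P i).2 ((P (i + 1)).1 - (P i).1) ≤ ‖D‖ ^ 2 / N ^ 2 := by
      intro i _
      rw [← inner_sub_left]
      refine (inner_le_norm_add_sq (hA.1 _ (hPA i) _ (hPA (i + 1)))).trans_eq ?_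
      have h2 : (P (i + 1)).1 - (P i).1 + ((P (i + 1)).2 - (P i).2) = (1 / (N : ℝ)) • D := by
        have h3 : (P (i + 1)).1 - (P i).1 + ((P (i + 1)).2 - (P i).2) = u (i + 1) - u i := by
          simp only [P]
          abel
        rw [h3]
        simp only [u, Nat.cast_add, Nat.cast_one, add_div, add_smul]
        abel
      rw [h2, norm_smul, mul_pow, Real.norm_eq_abs, sq_abs]
      ring
    have h2 := Finset.sum_le_sum h1
    rw [Finset.sum_sub_distrib, Finset.sum_const, Finset.card_range, nsmul_eq_mul] at h2
    refine h2.trans ?_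
    rw [div_lt_iff₀ hε] at hN
    rw [show (N : ℝ) * (‖D‖ ^ 2 / N ^ 2) = ‖D‖ ^ 2 / N by field_simp, div_le_iff₀ hN0]
    linarith
  have hbase' := hbase.eventually (Icc_mem_nhds
    (sub_lt_self _ (by positivity : 0 < ε / 8)) (lt_add_of_pos_right _ (by positivity : 0 < ε / 8)))
  refine ⟨inner ℝ ξ z + β - ε / 8 + (SL - ε / 8), inner ℝ ξ z + β + ε / 8 + (SU + ε / 8),
    by linarith, ?_⟩
  filter_upwards [hev, hbase'] with τ h1 h2
  simp only [mem_Icc] at h1 h2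
  exact ⟨by linarith, by linarith⟩

/-- The resolvent points of `w` act as regularized recovery points. The subgradient inequality
there, tested on the weakly convergent epigraph points, gives `φ + α⁻¹ ‖w - a‖² ≤ l` for the
limiting value `φ`. -/
theorem mconvergesFun_of_isMaximalMonotoneOp [CompleteSpace H] {F : ℝ → H → EReal}
    {zf ξf : ℝ → H} {βf : ℝ → ℝ} {z ξ : H} {β : ℝ}
    (h : IsConvergentSupportingHyperplane F zf ξf βf z ξ β) (hF : ∀ τ, 0 < τ → F τ ∈ Gamma0 H)
    (hA : IsMaximalMonotoneOp (gLim fun τ => subdiff (F τ))) : MConvergesFun F := by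
  rintro ⟨w, l⟩ ⟨t, ht, q, hq, hqS⟩
  obtain ⟨hq1, hq2⟩ := weakTendsto_prod_iff.1 hq
  simp only at hq1 hq2
  obtain ⟨C, hC⟩ := exists_norm_le_of_weak hq1
  have key : ∀ α : ℝ, 0 < α → ∃ a : H, (a, l) ∈ innerLim (fun τ => epi (F τ)) ∧
      α⁻¹ * ‖w - a‖ ^ 2 ≤ l - inner ℝ ξ a - β := by
    intro α hα
    obtain ⟨a, ha⟩ := exists_resolvent_gLim h hF hA w hα
    obtain ⟨σ, hσ, hσS⟩ := exists_selection_of_mem_innerLim ha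
    obtain ⟨φ, hφ⟩ := exists_tendsto_value h hF hA hσ hσS
    have h1 : Tendsto (fun τ => (σ τ).1) (𝓝[>] 0) (𝓝 a) := (continuous_fst.tendsto _).comp hσ
    have h2 : Tendsto (fun τ => (σ τ).2) (𝓝[>] 0) (𝓝 (α⁻¹ • (w - a))) :=
      (continuous_snd.tendsto _).comp hσ
    have hepi : (a, φ) ∈ innerLim fun τ => epi (F τ) := by
      refine mem_innerLim_of_tendsto (h1.prodMk_nhds hφ) ?_
      filter_upwards [hσS] with τ hτ
      obtain ⟨r, hr, -⟩ := mem_subdiff_iff.1 hτ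
      simp [epi, hr]
    have h3 := (hφ.comp ht.tendsto).add ((tendsto_inner_of_strong_weak hC (h2.comp ht.tendsto)
      hq1).sub ((h2.comp ht.tendsto).inner (h1.comp ht.tendsto)))
    have h4 : φ + (inner ℝ (α⁻¹ • (w - a)) w - inner ℝ (α⁻¹ • (w - a)) a) ≤ l := by
      refine le_of_tendsto_of_tendsto h3 hq2 ?_
      filter_upwards [ht.tendsto.eventually hσS] with n hn
      obtain ⟨r, hr, hrp⟩ := mem_subdiff_iff.1 hn
      have h5 := hrp _ (hqS n)
      simp only [Function.comp_apply, hr, EReal.toReal_coe]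
      rw [inner_sub_right] at h5
      exact h5
    rw [← inner_sub_right, inner_smul_left, real_inner_self_eq_norm_sq, conj_trivial] at h4
    have h5 := h.le_of_mem_innerLim_epi hepi
    simp only at h5
    refine ⟨a, ?_, by linarith⟩
    rw [← epi_eLim] at hepi ⊢
    have h6 : φ ≤ l := by
      have : 0 ≤ α⁻¹ * ‖w - a‖ ^ 2 := by positivity
      linarith
    exact le_trans (show eLim F a ≤ (φ : EReal) from hepi) (EReal.coe_le_coe_iff.2 h6)
  have ht' := paramSeq_one_div
  choose a ha hna using fun n => key _ (ht'.1 n)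
  -- With `α = 1 / (n + 1)`, Young's inequality for `⟨ξ, w - a n⟩` leaves `(n + 1/2) ‖w - a n‖² ≤
  -- K`.
  set K := l - β - inner ℝ ξ w + ‖ξ‖ ^ 2 / 2
  have hsq : ∀ n : ℕ, ‖a n - w‖ ^ 2 ≤ 1 / ((n : ℝ) + 1) * (2 * K) := by
    intro n
    have h1 := hna n
    simp only [one_div, inv_inv] at h1
    have h2 : inner ℝ ξ (a n) = inner ℝ ξ w - inner ℝ ξ (w - a n) := by
      rw [inner_sub_right]; ring
    have h3 := real_inner_le_norm ξ (w - a n)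
    have h4 := sq_nonneg (‖ξ‖ - ‖w - a n‖)
    rw [norm_sub_rev, one_div, ← div_eq_inv_mul, le_div_iff₀ (by positivity)]
    have h5 : 0 ≤ (n : ℝ) * ‖w - a n‖ ^ 2 := by positivity
    simp only [K]
    linarith
  have hsq0 := squeeze_zero (fun n => sq_nonneg ‖a n - w‖) hsq
    (by simpa using ht'.2.mul_const (2 * K))
  have haw : Tendsto a atTop (𝓝 w) := by
    refine tendsto_iff_norm_sub_tendsto_zero.2 ?_
    simpa using hsq0.sqrt
  exact (isClosed_innerLim _).mem_of_tendsto (haw.prodMk_nhds tendsto_const_nhds)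
    (Eventually.of_forall ha)

/-- Mosco convergence of closed convex functions with convergent supporting hyperplanes amounts
to graphical convergence of their subdifferentials to a maximal monotone map. -/
theorem mconvergesFun_iff [CompleteSpace H] {F : ℝ → H → EReal}
    {zf ξf : ℝ → H} {βf : ℝ → ℝ} {z ξ : H} {β : ℝ}
    (h : IsConvergentSupportingHyperplane F zf ξf βf z ξ β) (hF : ∀ τ, 0 < τ → F τ ∈ Gamma0 H) :
    MConvergesFun F ↔ GConverges (fun τ => subdiff (F τ)) ∧
      IsMaximalMonotoneOp (gLim fun τ => subdiff (F τ)) := by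
  refine ⟨fun hM => ⟨?_, ?_⟩, fun hG => mconvergesFun_of_isMaximalMonotoneOp h hF hG.2⟩
  · exact (outerLim_graph_subdiff_subset h hM).trans (graph_subdiff_eLim_subset h hF hM)
  · rw [gLim_subdiff_eq h hF hM]
    -- Minty's criterion, with the limiting hyperplane as affine minorant.
    refine (isMonotoneOp_subdiff _).isMaximal fun u => ?_
    simpa using exists_resolvent_subdiff (h.eLim_mem_Gamma0 hF) h.le_eLim u one_pos

/-! ### Second-order difference quotients -/

theorem secondQuot_of_eq_coe {f : ℝ → H → EReal} {x v w : H} {τ c r : ℝ}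
    (hc : f τ x = c) (hr : f τ (x + τ • w) = r) :
    secondQuot f x v τ w = ((r - c - τ * inner ℝ v w) / τ ^ 2 : ℝ) := by
  simp only [secondQuot, hc, hr]
  norm_cast

theorem secondQuot_of_eq_top {f : ℝ → H → EReal} {x v w : H} {τ c : ℝ} (hτ : 0 < τ)
    (hc : f τ x = c) (hr : f τ (x + τ • w) = ⊤) : secondQuot f x v τ w = ⊤ := by
  simp only [secondQuot, hc, hr, EReal.top_sub_coe]
  exact EReal.top_div_of_pos_ne_top (by exact_mod_cast pow_pos hτ 2) (EReal.coe_ne_top _)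

/-- The affine change of variables through which closedness, convexity and subgradients are
transported. -/
theorem mem_epi_secondQuot_iff {f : ℝ → H → EReal} {x v : H} {τ c : ℝ} (hτ : 0 < τ)
    (hbot : ∀ y, f τ y ≠ ⊥) (hc : f τ x = c) {p : H × ℝ} :
    p ∈ epi (secondQuot f x v τ) ↔
      (x + τ • p.1, c + τ * inner ℝ v p.1 + τ ^ 2 * p.2) ∈ epi (f τ) := by
  cases hr : f τ (x + τ • p.1) with
  | bot => exact absurd hr (hbot _)
  | top =>
    simp only [epi, mem_ofPred_eq, secondQuot_of_eq_top hτ hc hr, hr, top_le_iff, EReal.coe_ne_top]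
  | coe r =>
    simp only [epi, mem_ofPred_eq, secondQuot_of_eq_coe hc hr, hr, EReal.coe_le_coe_iff]
    rw [div_le_iff₀ (pow_pos hτ 2)]
    constructor <;> intro h <;> linarith

theorem secondQuot_mem_Gamma0 {f : ℝ → H → EReal} {x v : H} {τ c : ℝ} (hτ : 0 < τ)
    (hf : f τ ∈ Gamma0 H) (hc : f τ x = c) : secondQuot f x v τ ∈ Gamma0 H := by
  obtain ⟨hbot, -, hcl, hcv⟩ := hf
  have hepi : epi (secondQuot f x v τ) =
      (fun p : H × ℝ => (x + τ • p.1, c + τ * inner ℝ v p.1 + τ ^ 2 * p.2)) ⁻¹' epi (f τ) := by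
    ext p
    exact mem_epi_secondQuot_iff hτ hbot hc
  refine ⟨fun w => ?_, ⟨0, ?_⟩, ?_, ?_⟩
  · cases hr : f τ (x + τ • w) with
    | bot => exact absurd hr (hbot _)
    | top => simp [secondQuot_of_eq_top hτ hc hr]
    | coe r =>
      rw [secondQuot_of_eq_coe hc hr]
      exact EReal.coe_ne_bot _
  · rw [secondQuot_of_eq_coe hc (by simpa using hc)]
    exact EReal.coe_ne_top _
  · rw [hepi]
    exact hcl.preimage (by fun_prop)
  · rw [hepi]
    intro p hp q hq a b ha hb hab
    have h1 := hcv hp hq ha hb hab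
    rw [mem_preimage]
    refine mem_of_eq_of_mem (Prod.ext ?_ ?_) h1
    · have h2 : x = (a + b) • x := by rw [hab, one_smul]
      simp only [Prod.fst_add, Prod.smul_fst]
      conv_lhs => rw [h2]
      module
    · have h2 : c = (a + b) * c := by rw [hab, one_mul]
      simp only [Prod.fst_add, Prod.smul_fst, Prod.snd_add, Prod.smul_snd, smul_eq_mul,
        inner_add_right, inner_smul_right]
      conv_lhs => rw [h2]
      ring

theorem secondQuot_zero {f : ℝ → H → EReal} {x v : H} {τ c : ℝ} (hc : f τ x = c) :
    secondQuot f x v τ 0 = 0 := by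
  rw [secondQuot_of_eq_coe hc (by simpa using hc)]
  simp

/-- Chain rule: `y` is a subgradient of the quotient at `w` exactly when `v + τ • y` is one of `f τ`
at `x + τ • w`. -/
theorem protoQuot_subdiffParam {f : ℝ → H → EReal} {x v : H} {τ c : ℝ} (hτ : 0 < τ)
    (hbot : ∀ y, f τ y ≠ ⊥) (hc : f τ x = c) :
    protoQuot (subdiffParam f) x v τ = subdiff (secondQuot f x v τ) := by
  ext w y
  have h1 : y ∈ protoQuot (subdiffParam f) x v τ w ↔
      v + τ • y ∈ subdiff (f τ) (x + τ • w) := by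
    constructor
    · rintro ⟨u, hu, rfl⟩
      rw [smul_inv_smul₀ hτ.ne', add_sub_cancel]
      exact hu
    · intro hu
      exact ⟨_, hu, by simp only [add_sub_cancel_left, inv_smul_smul₀ hτ.ne']⟩
  rw [h1, mem_subdiff_iff, mem_subdiff_iff]
  have hτ2 : 0 < τ ^ 2 := pow_pos hτ 2
  constructor
  · rintro ⟨r, hr, h⟩
    refine ⟨_, secondQuot_of_eq_coe hc hr, fun p hp => ?_⟩
    have h2 := h _ ((mem_epi_secondQuot_iff hτ hbot hc).1 hp)
    simp only [add_sub_add_left_eq_sub, ← smul_sub, inner_add_left, inner_smul_left,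
      inner_smul_right, conj_trivial, inner_sub_right] at h2
    rw [inner_sub_right, ← le_sub_iff_add_le, div_le_iff₀ hτ2]
    linarith
  · rintro ⟨r, hr, h⟩
    cases hs : f τ (x + τ • w) with
    | bot => exact absurd hs (hbot _)
    | top => simp [secondQuot_of_eq_top hτ hc hs] at hr
    | coe s =>
      rw [secondQuot_of_eq_coe hc hs, EReal.coe_eq_coe_iff] at hr
      refine ⟨s, rfl, fun p hp => ?_⟩
      -- The preimage of `p` under the affine change of variables.
      set q : H × ℝ := (τ⁻¹ • (p.1 - x),
        (p.2 - c - τ * inner ℝ v (τ⁻¹ • (p.1 - x))) / τ ^ 2) with hq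
      have h2 : x + τ • q.1 = p.1 := by
        rw [hq, smul_inv_smul₀ hτ.ne', add_sub_cancel]
      have h3 : c + τ * inner ℝ v q.1 + τ ^ 2 * q.2 = p.2 := by
        rw [hq]
        field_simp
        ring
      have h4 := h q ((mem_epi_secondQuot_iff hτ hbot hc).2 (by rw [h2, h3]; exact hp))
      rw [← hr, inner_sub_right, ← le_sub_iff_add_le, div_le_iff₀ hτ2] at h4
      rw [← h2, ← h3]
      simp only [add_sub_add_left_eq_sub, ← smul_sub, inner_add_left, inner_smul_left,
        inner_smul_right, conj_trivial, inner_sub_right]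
      linarith

end EpiProto

end

/-! ### Twice epi-differentiability and proto-differentiability -/

theorem mainTheorem3 {H : Type*} [NormedAddCommGroup H] [InnerProductSpace ℝ H] [CompleteSpace H]
    (f : ℝ → H → EReal) (hf : f ∈ EpiProto.Gamma0Param H)
    (x : H) (hx : x ∈ EpiProto.finitePoints f)
    (v : H) (hv : v ∈ EpiProto.subdiffParam f 0 x)
    (zf ξf : ℝ → H) (βf : ℝ → ℝ) (z ξ : H) (β : ℝ)
    (hcsh : EpiProto.IsConvergentSupportingHyperplane
      (EpiProto.secondQuot f x v) zf ξf βf z ξ β) :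
    (EpiProto.TwiceEpiDiffAt f x v ↔
      (EpiProto.ProtoDiffAt (EpiProto.subdiffParam f) x v ∧
        EpiProto.IsMaximalMonotoneOp
          (EpiProto.protoDeriv (EpiProto.subdiffParam f) x v))) ∧
    (EpiProto.TwiceEpiDiffAt f x v →
      EpiProto.secondEpiDeriv f x v ∈ EpiProto.Gamma0 H ∧
      (β : EReal) ≤ EpiProto.secondEpiDeriv f x v 0 ∧
      EpiProto.secondEpiDeriv f x v 0 ≤ 0 ∧
      EpiProto.protoDeriv (EpiProto.subdiffParam f) x v =
        EpiProto.subdiff (EpiProto.secondEpiDeriv f x v)) := by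
  have hc : ∀ τ, 0 < τ → f τ x = ((f τ x).toReal : EReal) := fun τ hτ =>
    (EReal.coe_toReal (hx τ hτ.le).2 (hx τ hτ.le).1).symm
  have hF : ∀ τ, 0 < τ → EpiProto.secondQuot f x v τ ∈ EpiProto.Gamma0 H := fun τ hτ =>
    EpiProto.secondQuot_mem_Gamma0 hτ (hf τ hτ.le) (hc τ hτ)
  have hgraph : ∀ τ, 0 < τ →
      EpiProto.graph (EpiProto.protoQuot (EpiProto.subdiffParam f) x v τ) =
        EpiProto.graph (EpiProto.subdiff (EpiProto.secondQuot f x v τ)) := fun τ hτ => by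
    rw [EpiProto.protoQuot_subdiffParam hτ (hf τ hτ.le).1 (hc τ hτ)]
  have hderiv : EpiProto.protoDeriv (EpiProto.subdiffParam f) x v =
      EpiProto.gLim fun τ => EpiProto.subdiff (EpiProto.secondQuot f x v τ) := by
    funext w
    exact congrArg (fun S : Set (H × H) => {y | (w, y) ∈ S}) (EpiProto.innerLim_congr hgraph)
  have hproto : EpiProto.ProtoDiffAt (EpiProto.subdiffParam f) x v ↔
      EpiProto.GConverges fun τ => EpiProto.subdiff (EpiProto.secondQuot f x v τ) := by
    simp only [EpiProto.ProtoDiffAt, EpiProto.GConverges, EpiProto.PKConverges]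
    rw [EpiProto.innerLim_congr hgraph, EpiProto.outerLim_congr hgraph]
  rw [hproto, hderiv]
  refine ⟨EpiProto.mconvergesFun_iff hcsh hF, fun hM => ⟨hcsh.eLim_mem_Gamma0 hF, ?_, ?_,
    EpiProto.gLim_subdiff_eq hcsh hF hM⟩⟩
  · have h0 := hcsh.le_eLim 0
    rwa [inner_zero_right, zero_add] at h0
  · have h0 : ((0 : H), (0 : ℝ)) ∈
        EpiProto.innerLim fun τ => EpiProto.epi (EpiProto.secondQuot f x v τ) := by
      refine EpiProto.mem_innerLim_of_tendsto tendsto_const_nhds ?_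
      filter_upwards [self_mem_nhdsWithin] with τ hτ
      exact (EpiProto.secondQuot_zero (hc τ hτ)).le
    exact (EpiProto.epi_eLim _).ge h0
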